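/- Let $E$ be the set of undirected nearest neighbour edges of $\mathbb Z^2$ and let $\{t_e : e\in E\}$ be i.i.d. nonnegative random variables on a probability space $(\Omega,\mathcal F,P)$ with $E[e^{c_0t_e}]<\infty$ for some $c_0>0$. The value of a finite nearest neighbour path $\gamma$ is $V(\gamma)=\sum_{e\in\gamma}t_e$ (edges counted with multiplicity). Let $a_n$ be the infimum of $V(\gamma)$ over all paths $\gamma$ from $(0,0)$ to $(n,0)$, and let $\nu\ge 0$ be the nonrandom constant with $\lim_{n\to\infty}a_n/n=\nu$ almost surely. For integers $n,l\ge1$, a real $\delta\in(0,1/2)$ and integers $0\le k\le 2\delta n/l$, set $$A_k=[-\delta n+kl,\,-\delta n+(k+1)l]\cap\mathbb Z .$$ For $\varepsilon>0$, call the channel $A_k$ *good* if for all $x\in A_k\times\{\lfloor\delta n\rfloor\}$ and $y\in A_k\times\{\lfloor(1-\delta)n\rfloor\}$ there is a path $\gamma$ from $x$ to $y$, all of whose vertices lie in $A_k\times\mathbb Z$, with $V(\gamma)\le(\nu+\varepsilon/5)(1-2\delta)n$. Let $$\tilde G_{\delta n,n}=\Big\{\,\big|\{k:0\le k\le 2\delta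 n/l,\ A_k\text{ is good}\}\big|\ge\tfrac9{10}\cdot\tfrac{2\delta n}{l}\Big\}.$$ **Proposition 2.2.** There are $\varepsilon_0>0$ and $\delta_0>0$ such that for every $\varepsilon\in(0,\varepsilon_0)$ there is an integer $l_0\ge1$ with the following property: for every integer $l\ge l_0$ and every $\delta\in(0,\delta_0)$ there are $c>0$ and $n_0$ such that for all $n\ge n_0$ $$P(\tilde G_{\delta n,n})\ge 1-e^{-cn^2}.$$ -/

import Mathlib

open MeasureTheory ProbabilityTheory Filter Topology

noncomputable section

namespace FPP

/-- The nearest neighbour graph on `ℤ²`: `x ∼ y` iff `|x - y|₁ = 1`. -/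
def latticeGraph : SimpleGraph (ℤ × ℤ) where
  Adj x y := |x.1 - y.1| + |x.2 - y.2| = 1
  symm := ⟨fun x y h => by rwa [abs_sub_comm y.1 x.1, abs_sub_comm y.2 x.2]⟩
  loopless := ⟨fun x h => by simp at h⟩

/-- The set `E` of undirected nearest neighbour edges of `ℤ²`. -/
abbrev Edge : Type := latticeGraph.edgeSet

/-- The value (passage time) `V(γ) = ∑_{e ∈ γ} w_e` of a finite nearest neighbour path `γ`; an edge
that is crossed several times is counted each time. -/
def passageTime (w : Edge → ℝ) : {x y : ℤ × ℤ} → latticeGraph.Walk x y → ℝ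
  | _, _, .nil => 0
  | _, _, .cons (u := u) (v := v) h p =>
      w ⟨s(u, v), latticeGraph.mem_edgeSet.2 h⟩ + passageTime w p

/-- `a_n = inf V(γ)` over all finite nearest neighbour paths `γ` from `(0,0)` to `(n,0)`. -/
def pointToPoint (w : Edge → ℝ) (n : ℕ) : ℝ :=
  ⨅ γ : latticeGraph.Walk ((0 : ℤ), (0 : ℤ)) ((n : ℤ), (0 : ℤ)), passageTime w γ

/-- The time constant `ν`, that is, the almost sure value of `lim a_n / n`. To have a number that is
defined without knowing beforehand that the limit exists and is nonrandom, it is written as the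
essential supremum of `limsup a_n / n`; see `timeConstant_eq` below. -/
def timeConstant {Ω : Type*} [MeasurableSpace Ω] (P : Measure Ω) (t : Edge → Ω → ℝ) : ℝ :=
  essSup (fun ω => limsup (fun n : ℕ => pointToPoint (fun e => t e ω) n / n) atTop) P

/-- If `a_n / n` converges almost surely to a nonrandom `ν`, then `ν` is the time constant. -/
theorem timeConstant_eq {Ω : Type*} [MeasurableSpace Ω] (P : Measure Ω) [IsProbabilityMeasure P]
    (t : Edge → Ω → ℝ) (ν : ℝ)
    (h : ∀ᵐ ω ∂P, Tendsto (fun n : ℕ => pointToPoint (fun e => t e ω) n / n) atTop (𝓝 ν)) :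
    timeConstant P t = ν := by
  have h' : (fun ω => limsup (fun n : ℕ => pointToPoint (fun e => t e ω) n / n) atTop)
      =ᵐ[P] fun _ => ν := h.mono fun ω hω => hω.limsup_eq
  rw [timeConstant, essSup_congr_ae h', essSup_const _ (IsProbabilityMeasure.ne_zero P)]

/-- The base `A_k = [-δn + kl, -δn + (k+1)l]` (a set of lattice points) of the `k`th channel. -/
def channelBase (δ : ℝ) (n l k : ℕ) : Set ℤ :=
  {z : ℤ | -(δ * n) + k * l ≤ (z : ℝ) ∧ (z : ℝ) ≤ -(δ * n) + (k + 1) * l}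

/-- The `k`th channel is good (for the weights `w` and the constant `ν`): every entry point
`(a, ⌊δn⌋)` and every exit point `(b, ⌊(1-δ)n⌋)` with `a, b ∈ A_k` are joined by a path that stays
in `A_k × ℤ` and has value at most `(ν + ε/5)(1-2δ)n`. -/
def GoodChannel (w : Edge → ℝ) (ν ε δ : ℝ) (n l k : ℕ) : Prop :=
  ∀ a ∈ channelBase δ n l k, ∀ b ∈ channelBase δ n l k,
    ∃ γ : latticeGraph.Walk (a, ⌊δ * n⌋) (b, ⌊(1 - δ) * n⌋),
      (∀ v ∈ γ.support, v.1 ∈ channelBase δ n l k) ∧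
      passageTime w γ ≤ (ν + ε / 5) * (1 - 2 * δ) * n

/-- Among the channels `k = 0, 1, …, ⌊2δn/l⌋`, at least `(9/10)(2δn/l)` are good. -/
def MostChannelsGood (w : Edge → ℝ) (ν ε δ : ℝ) (n l : ℕ) : Prop :=
  9 / 10 * (2 * δ * n / l) ≤
    (({k : ℕ | (k : ℝ) ≤ 2 * δ * n / l ∧ GoodChannel w ν ε δ n l k}.ncard : ℕ) : ℝ)

end FPP

end

set_option linter.unusedSectionVars false

/-! Let `ν` be the time constant and `τ = ν + ε/10`. Since `τ > ν`, some finite box `[0, L] × [-M,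
M]` has expected crossing time, by paths inside the box, strictly below `τL`
(`exists_integral_boxEdges_lt`). With `T` this crossing time, `T - τL` has negative mean and
exponential moments, so `E exp(θ(T - τL)) ≤ 1` for some `θ > 0` (`exists_exponent`).

A channel of width `l ≥ 2M + 1` contains a stack of about `(1 - 2δ)n / L` rotated copies of the box,
with disjoint edge sets. At most `2l + L` further edges connect the stack to all entry and exit
points. Hence the total cost of a channel, with `τ` per unit height subtracted, has moment
generating function at `θ` bounded by a constant `C` independent of `n` (`prod_mgf_channelCost_le`).
A bad channel forces this cost above `u = εn/20 - τ`, which has probability at most `C exp(-θu) =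
exp(-Ω(n))`.

Different channels use disjoint edges and are independent. If too few channels are good, there are
at least `δn/(5l)` bad ones. The `2^{O(n)}` possible sets of bad channels are covered by a union
bound (`prob_many_large_le`), each contributing `exp(-Ω(n²))`.

Only the almost sure bound `limsup a_n / n ≤ ν` enters. Fatou's lemma turns it into a bound on `E
a_N` for a single `N`, so no ergodic theorem is needed. -/

namespace FPP

/-! ### Passage times of paths. -/

section Walks

variable {w : Edge → ℝ} {x y z : ℤ × ℤ}

lemma passageTime_nonneg (hw : ∀ e, 0 ≤ w e) : ∀ {x y : ℤ × ℤ} (γ : latticeGraph.Walk x y),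
    0 ≤ passageTime w γ
  | _, _, .nil => le_rfl
  | _, _, .cons _ p => add_nonneg (hw _) (passageTime_nonneg hw p)

lemma passageTime_append : ∀ {x y z : ℤ × ℤ} (γ : latticeGraph.Walk x y)
    (γ' : latticeGraph.Walk y z),
    passageTime w (γ.append γ') = passageTime w γ + passageTime w γ'
  | _, _, _, .nil, γ' => by simp [passageTime]
  | _, _, _, .cons _ p, γ' => by
    simp [passageTime, passageTime_append p γ', add_assoc]

lemma passageTime_reverse : ∀ {x y : ℤ × ℤ} (γ : latticeGraph.Walk x y),
    passageTime w γ.reverse = passageTime w γ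
  | _, _, .nil => rfl
  | _, _, .cons h p => by
    simp only [SimpleGraph.Walk.reverse_cons, passageTime_append, passageTime_reverse p,
      passageTime, add_zero]
    rw [add_comm]
    congr 2
    exact Subtype.ext Sym2.eq_swap

lemma passageTime_map (w : Edge → ℝ) (φ : latticeGraph ≃g latticeGraph) :
    ∀ {x y : ℤ × ℤ} (γ : latticeGraph.Walk x y),
    passageTime w (γ.map φ.toHom) = passageTime (fun e => w (φ.mapEdgeSet e)) γ
  | _, _, .nil => rfl
  | _, _, .cons h p => by
    simp only [SimpleGraph.Walk.map_cons, passageTime, passageTime_map w φ p]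
    rfl

lemma passageTime_congr {w w' : Edge → ℝ} : ∀ {x y : ℤ × ℤ} (γ : latticeGraph.Walk x y),
    (∀ e : Edge, e.1 ∈ γ.edges → w e = w' e) → passageTime w γ = passageTime w' γ
  | _, _, .nil, _ => rfl
  | _, _, .cons h p, H => by
    simp only [passageTime]
    rw [passageTime_congr p fun e he => H e (by simp [he]), H _ (by simp)]

@[fun_prop]
lemma measurable_passageTime : ∀ {x y : ℤ × ℤ} (γ : latticeGraph.Walk x y),
    Measurable fun w : Edge → ℝ => passageTime w γ
  | _, _, .nil => measurable_const
  | _, _, .cons _ p => (measurable_pi_apply _).add (measurable_passageTime p)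

instance countable_walk : Countable (latticeGraph.Walk x y) :=
  Function.Injective.countable (f := fun γ => γ.support)
    fun _ _ h => SimpleGraph.Walk.ext_support h

end Walks

/-! ### Passage times restricted to a set of edges. -/

/-- The infimum of the passage times of the paths from `x` to `y` that only use edges of `F`. -/
noncomputable def restrictedTime (F : Set (Sym2 (ℤ × ℤ))) (x y : ℤ × ℤ) (w : Edge → ℝ) : ℝ :=
  ⨅ γ : {γ : latticeGraph.Walk x y // ∀ e ∈ γ.edges, e ∈ F}, passageTime w γ.1

/-- Some path from `x` to `y` only uses edges of `F`. -/
def Joined (F : Set (Sym2 (ℤ × ℤ))) (x y : ℤ × ℤ) : Prop :=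
  ∃ γ : latticeGraph.Walk x y, ∀ e ∈ γ.edges, e ∈ F

section RestrictedTime

variable {w : Edge → ℝ} {x y z : ℤ × ℤ} {F F' : Set (Sym2 (ℤ × ℤ))}

lemma restrictedTime_nonneg (hw : ∀ e, 0 ≤ w e) : 0 ≤ restrictedTime F x y w :=
  Real.iInf_nonneg fun γ => passageTime_nonneg hw γ.1

lemma bddBelow_passageTime (hw : ∀ e, 0 ≤ w e) : BddBelow (Set.range
    fun γ : {γ : latticeGraph.Walk x y // ∀ e ∈ γ.edges, e ∈ F} => passageTime w γ.1) :=
  ⟨0, by rintro _ ⟨γ, rfl⟩; exact passageTime_nonneg hw γ.1⟩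

lemma restrictedTime_le (hw : ∀ e, 0 ≤ w e) (γ : latticeGraph.Walk x y)
    (hγ : ∀ e ∈ γ.edges, e ∈ F) : restrictedTime F x y w ≤ passageTime w γ :=
  ciInf_le (bddBelow_passageTime hw)
    (⟨γ, hγ⟩ : {γ : latticeGraph.Walk x y // ∀ e ∈ γ.edges, e ∈ F})

/-- `Joined` is indispensable: a real infimum over an empty family is `0`, so without a path
`restrictedTime` carries no information. The strict inequality is needed because the infimum need
not be attained. -/
lemma exists_walk_of_restrictedTime_lt (h : Joined F x y) {r : ℝ}
    (hr : restrictedTime F x y w < r) :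
    ∃ γ : latticeGraph.Walk x y, (∀ e ∈ γ.edges, e ∈ F) ∧ passageTime w γ < r := by
  obtain ⟨γ₀, h₀⟩ := h
  have : Nonempty {γ : latticeGraph.Walk x y // ∀ e ∈ γ.edges, e ∈ F} := ⟨⟨γ₀, h₀⟩⟩
  obtain ⟨γ, hγ⟩ := exists_lt_of_ciInf_lt hr
  exact ⟨γ.1, γ.2, hγ⟩

lemma Joined.mono (h : Joined F x y) (hF : F ⊆ F') : Joined F' x y :=
  h.imp fun _ hγ e he => hF (hγ e he)

lemma Joined.trans (h : Joined F x y) (h' : Joined F y z) : Joined F x z := by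
  obtain ⟨γ, hγ⟩ := h
  obtain ⟨γ', hγ'⟩ := h'
  refine ⟨γ.append γ', fun e he => ?_⟩
  rw [SimpleGraph.Walk.edges_append, List.mem_append] at he
  exact he.elim (hγ e) (hγ' e)

lemma restrictedTime_triangle (hw : ∀ e, 0 ≤ w e) (h : Joined F x y) (h' : Joined F y z) :
    restrictedTime F x z w ≤ restrictedTime F x y w + restrictedTime F y z w := by
  refine le_of_forall_pos_le_add fun ε hε => ?_
  obtain ⟨γ, hγ, hγ1⟩ := exists_walk_of_restrictedTime_lt (w := w) h
    (lt_add_of_pos_right _ (half_pos hε))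
  obtain ⟨γ', hγ', hγ1'⟩ := exists_walk_of_restrictedTime_lt (w := w) h'
    (lt_add_of_pos_right _ (half_pos hε))
  have := restrictedTime_le (F := F) hw (γ.append γ') (fun e he => by
    rw [SimpleGraph.Walk.edges_append, List.mem_append] at he
    exact he.elim (hγ e) (hγ' e))
  rw [passageTime_append] at this
  linarith

lemma restrictedTime_map_le (hw : ∀ e, 0 ≤ w e) (φ : latticeGraph ≃g latticeGraph)
    (h : Joined F x y) (hF : ∀ e ∈ F, Sym2.map φ e ∈ F') :
    restrictedTime F' (φ x) (φ y) w ≤ restrictedTime F x y fun e => w (φ.mapEdgeSet e) := by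
  obtain ⟨γ₀, h₀⟩ := h
  have : Nonempty {γ : latticeGraph.Walk x y // ∀ e ∈ γ.edges, e ∈ F} := ⟨⟨γ₀, h₀⟩⟩
  refine le_ciInf fun γ => ?_
  rw [← passageTime_map]
  refine restrictedTime_le hw (γ.1.map φ.toHom) fun e he => ?_
  rw [SimpleGraph.Walk.edges_map, List.mem_map] at he
  obtain ⟨e', he', rfl⟩ := he
  exact hF _ (γ.2 e' he')

lemma Joined.map (φ : latticeGraph ≃g latticeGraph) (h : Joined F x y)
    (hF : ∀ e ∈ F, Sym2.map φ e ∈ F') : Joined F' (φ x) (φ y) := by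
  obtain ⟨γ, hγ⟩ := h
  refine ⟨γ.map φ.toHom, fun e he => ?_⟩
  rw [SimpleGraph.Walk.edges_map, List.mem_map] at he
  obtain ⟨e', he', rfl⟩ := he
  exact hF _ (hγ e' he')

lemma restrictedTime_mono (hw : ∀ e, 0 ≤ w e) (h : Joined F x y) (hF : F ⊆ F') :
    restrictedTime F' x y w ≤ restrictedTime F x y w := by
  obtain ⟨γ₀, h₀⟩ := h
  have : Nonempty {γ : latticeGraph.Walk x y // ∀ e ∈ γ.edges, e ∈ F} := ⟨⟨γ₀, h₀⟩⟩
  exact le_ciInf fun γ => restrictedTime_le hw γ.1 fun e he => hF (γ.2 e he)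

lemma restrictedTime_congr {w w' : Edge → ℝ} (h : ∀ e : Edge, e.1 ∈ F → w e = w' e) :
    restrictedTime F x y w = restrictedTime F x y w' := by
  unfold restrictedTime
  congr 1 with γ
  exact passageTime_congr γ.1 fun e he => h e (γ.2 _ he)

@[fun_prop]
lemma measurable_restrictedTime : Measurable (restrictedTime F x y) :=
  Measurable.iInf fun γ => measurable_passageTime γ.1

lemma restrictedTime_univ (w : Edge → ℝ) (n : ℕ) :
    restrictedTime Set.univ (0, 0) ((n : ℤ), 0) w = pointToPoint w n :=
  Function.Surjective.iInf_congr Subtype.val (fun γ => ⟨⟨γ, by simp⟩, rfl⟩) fun _ => rfl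

end RestrictedTime

/-! ### Lattice symmetries and straight paths. -/

/-- The lattice automorphism `v ↦ v + a`. -/
def shift (a : ℤ × ℤ) : latticeGraph ≃g latticeGraph where
  toEquiv := Equiv.addRight a
  map_rel_iff' := by intro x y; simp [latticeGraph]

/-- The lattice automorphism that exchanges the coordinates. -/
def swap : latticeGraph ≃g latticeGraph where
  toEquiv := Equiv.prodComm ℤ ℤ
  map_rel_iff' := by intro x y; simp [latticeGraph, add_comm]

@[simp] lemma shift_apply (a v : ℤ × ℤ) : shift a v = v + a := rfl

@[simp] lemma swap_apply (v : ℤ × ℤ) : swap v = (v.2, v.1) := rfl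

lemma adj_add_right (v : ℤ × ℤ) : latticeGraph.Adj v (v + (1, 0)) := by simp [latticeGraph]

/-- The edge from `v` to its right neighbour. -/
def rightEdge (v : ℤ × ℤ) : Edge := ⟨s(v, v + (1, 0)), adj_add_right v⟩

lemma adj_add_up (v : ℤ × ℤ) : latticeGraph.Adj v (v + (0, 1)) := by simp [latticeGraph]

/-- The edge from `v` to its upper neighbour. -/
def upEdge (v : ℤ × ℤ) : Edge := ⟨s(v, v + (0, 1)), adj_add_up v⟩

lemma rightEdge_injective : Function.Injective rightEdge := by
  intro u v h
  have h' := congrArg Subtype.val h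
  simp only [rightEdge, Sym2.eq_iff, Prod.ext_iff, Prod.fst_add, Prod.snd_add] at h'
  ext <;> omega

lemma upEdge_injective : Function.Injective upEdge := by
  intro u v h
  have h' := congrArg Subtype.val h
  simp only [upEdge, Sym2.eq_iff, Prod.ext_iff, Prod.fst_add, Prod.snd_add] at h'
  ext <;> omega

lemma exists_walk_right (w : Edge → ℝ) (v : ℤ × ℤ) : ∀ m : ℕ,
    ∃ γ : latticeGraph.Walk v (v + ((m : ℤ), 0)),
      (∀ e ∈ γ.edges, ∃ i < m, e = rightEdge (v + ((i : ℤ), 0))) ∧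
      passageTime w γ = ∑ i ∈ Finset.range m, w (rightEdge (v + ((i : ℤ), 0)))
  | 0 => ⟨SimpleGraph.Walk.nil.copy rfl (by ext <;> simp), by simp, by
      have : ∀ {u : ℤ × ℤ} (h : v = u),
          passageTime w ((SimpleGraph.Walk.nil : latticeGraph.Walk v v).copy rfl h) = 0 := by
        rintro _ rfl; rfl
      simp [this]⟩
  | m + 1 => by
    obtain ⟨γ, h1, h2⟩ := exists_walk_right w v m
    have hs : v + ((m : ℤ), 0) + (1, 0) = v + (((m + 1 : ℕ) : ℤ), 0) := by
      ext <;> simp [add_assoc]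
    rw [← hs]
    refine ⟨γ.append (.cons (adj_add_right _) .nil), fun e he => ?_, ?_⟩
    · rw [SimpleGraph.Walk.edges_append, List.mem_append] at he
      rcases he with he | he
      · obtain ⟨i, hi, rfl⟩ := h1 e he
        exact ⟨i, by omega, rfl⟩
      · simp at he
        exact ⟨m, by omega, he⟩
    · rw [passageTime_append, h2, Finset.sum_range_succ]
      simp [passageTime, rightEdge]

lemma swap_mapEdgeSet_rightEdge (v : ℤ × ℤ) :
    swap.mapEdgeSet (rightEdge v) = upEdge (v.2, v.1) := by
  apply Subtype.ext
  simp [rightEdge, upEdge, SimpleGraph.Hom.mapEdgeSet]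

lemma exists_walk_up (w : Edge → ℝ) (v : ℤ × ℤ) (m : ℕ) :
    ∃ γ : latticeGraph.Walk v (v + (0, (m : ℤ))),
      (∀ e ∈ γ.edges, ∃ i < m, e = upEdge (v + (0, (i : ℤ)))) ∧
      passageTime w γ = ∑ i ∈ Finset.range m, w (upEdge (v + (0, (i : ℤ)))) := by
  obtain ⟨γ, h1, h2⟩ := exists_walk_right (fun e => w (swap.mapEdgeSet e)) (v.2, v.1) m
  suffices H : ∃ γ : latticeGraph.Walk (swap.toHom (v.2, v.1))
      (swap.toHom ((v.2, v.1) + ((m : ℤ), 0))),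
      (∀ e ∈ γ.edges, ∃ i < m, e = upEdge (v + (0, (i : ℤ)))) ∧
      passageTime w γ = ∑ i ∈ Finset.range m, w (upEdge (v + (0, (i : ℤ)))) from H
  refine ⟨γ.map swap.toHom, fun e he => ?_, ?_⟩
  · rw [SimpleGraph.Walk.edges_map, List.mem_map] at he
    obtain ⟨e', he', rfl⟩ := he
    obtain ⟨i, hi, rfl⟩ := h1 e' he'
    exact ⟨i, hi, congrArg Subtype.val (swap_mapEdgeSet_rightEdge _)⟩
  · rw [passageTime_map, h2]
    exact Finset.sum_congr rfl fun i _ => by rw [swap_mapEdgeSet_rightEdge]; rfl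

section Straight

variable {w : Edge → ℝ} {F : Set (Sym2 (ℤ × ℤ))} {v : ℤ × ℤ} {m : ℕ}

lemma joined_right (h : ∀ i < m, (rightEdge (v + ((i : ℤ), 0))).1 ∈ F) :
    Joined F v (v + ((m : ℤ), 0)) := by
  obtain ⟨γ, h1, -⟩ := exists_walk_right (fun _ => 0) v m
  refine ⟨γ, fun e he => ?_⟩
  obtain ⟨i, hi, rfl⟩ := h1 e he
  exact h i hi

lemma restrictedTime_le_sum_right (hw : ∀ e, 0 ≤ w e)
    (h : ∀ i < m, (rightEdge (v + ((i : ℤ), 0))).1 ∈ F) :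
    restrictedTime F v (v + ((m : ℤ), 0)) w
      ≤ ∑ i ∈ Finset.range m, w (rightEdge (v + ((i : ℤ), 0))) := by
  obtain ⟨γ, h1, h2⟩ := exists_walk_right w v m
  rw [← h2]
  refine restrictedTime_le hw γ fun e he => ?_
  obtain ⟨i, hi, rfl⟩ := h1 e he
  exact h i hi

end Straight

/-! ### From the almost sure time constant to a bound on the mean of `a_N`. -/

/-- I.i.d. nonnegative edge weights with a finite exponential moment. -/
structure IIDWeights {Ω : Type*} [MeasurableSpace Ω] (P : Measure Ω) (t : Edge → Ω → ℝ) :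
    Prop where
  measurable : ∀ e, Measurable (t e)
  indep : iIndepFun t P
  ident : ∀ e e', IdentDistrib (t e) (t e') P P
  nonneg : ∀ e ω, 0 ≤ t e ω
  exp_moment : ∃ c₀ : ℝ, 0 < c₀ ∧ ∀ e, Integrable (fun ω => Real.exp (c₀ * t e ω)) P

instance : Countable Edge := inferInstanceAs (Countable latticeGraph.edgeSet)

/-- The expected weight of an edge. -/
noncomputable def meanWeight {Ω : Type*} [MeasurableSpace Ω] (P : Measure Ω)
    (t : Edge → Ω → ℝ) : ℝ := ∫ ω, t (rightEdge (0, 0)) ω ∂P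

namespace IIDWeights

variable {Ω : Type*} [MeasurableSpace Ω] {P : Measure Ω} [IsProbabilityMeasure P]
  {t : Edge → Ω → ℝ}

lemma measurable_pi (ht : IIDWeights P t) : Measurable fun ω e => t e ω :=
  measurable_pi_lambda _ ht.measurable

lemma integrable (ht : IIDWeights P t) (e : Edge) : Integrable (t e) P := by
  obtain ⟨c₀, hc, h⟩ := ht.exp_moment
  refine ((h e).div_const c₀).mono' (ht.measurable e).aestronglyMeasurable
    (.of_forall fun ω => ?_)
  rw [Real.norm_of_nonneg (ht.nonneg e ω), le_div_iff₀ hc]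
  have := Real.add_one_le_exp (c₀ * t e ω)
  linarith

lemma integral_eq (ht : IIDWeights P t) (e : Edge) : ∫ ω, t e ω ∂P = meanWeight P t :=
  (ht.ident _ _).integral_eq

/-- The joint law of i.i.d. weights is a power of one law, hence invariant under relabelling the
edges. This provides translation and rotation invariance. -/
lemma identDistrib_comp (ht : IIDWeights P t) {f : (Edge → ℝ) → ℝ} (hf : Measurable f)
    (σ : Edge ≃ Edge) :
    IdentDistrib (fun ω => f fun e => t (σ e) ω) (fun ω => f fun e => t e ω) P P :=
  (IdentDistrib.pi (fun _ => ht.ident _ _) (ht.indep.precomp σ.injective) ht.indep).comp hf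

lemma integrable_sum (ht : IIDWeights P t) (v : ℤ × ℤ) (m : ℕ) :
    Integrable (fun ω => ∑ i ∈ Finset.range m, t (rightEdge (v + ((i : ℤ), 0))) ω) P :=
  integrable_finsetSum _ fun _ _ => ht.integrable _

lemma integral_sum (ht : IIDWeights P t) (v : ℤ × ℤ) (m : ℕ) :
    ∫ ω, ∑ i ∈ Finset.range m, t (rightEdge (v + ((i : ℤ), 0))) ω ∂P = m * meanWeight P t := by
  rw [integral_finsetSum _ fun _ _ => ht.integrable _]
  simp [ht.integral_eq]

lemma integrable_restrictedTime (ht : IIDWeights P t) {F : Set (Sym2 (ℤ × ℤ))} {v : ℤ × ℤ} {m : ℕ}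
    (h : ∀ i < m, (rightEdge (v + ((i : ℤ), 0))).1 ∈ F) :
    Integrable (fun ω => restrictedTime F v (v + ((m : ℤ), 0)) fun e => t e ω) P := by
  refine (ht.integrable_sum v m).mono'
    (measurable_restrictedTime.comp ht.measurable_pi).aestronglyMeasurable (.of_forall fun ω => ?_)
  rw [Real.norm_of_nonneg (restrictedTime_nonneg fun e => ht.nonneg e ω)]
  exact restrictedTime_le_sum_right (fun e => ht.nonneg e ω) h

lemma integral_restrictedTime_le_sum (ht : IIDWeights P t) {F : Set (Sym2 (ℤ × ℤ))} {v : ℤ × ℤ}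
    {m : ℕ} (h : ∀ i < m, (rightEdge (v + ((i : ℤ), 0))).1 ∈ F) :
    ∫ ω, restrictedTime F v (v + ((m : ℤ), 0)) (fun e => t e ω) ∂P ≤ m * meanWeight P t := by
  rw [← ht.integral_sum v m]
  exact integral_mono (ht.integrable_restrictedTime h) (ht.integrable_sum v m) fun ω =>
    restrictedTime_le_sum_right (fun e => ht.nonneg e ω) h

lemma pointToPoint_nonneg (ht : IIDWeights P t) (ω : Ω) (n : ℕ) :
    0 ≤ pointToPoint (fun e => t e ω) n := by
  rw [← restrictedTime_univ]
  exact restrictedTime_nonneg fun e => ht.nonneg e ω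

lemma pointToPoint_le (ht : IIDWeights P t) (ω : Ω) (n : ℕ) :
    pointToPoint (fun e => t e ω) n ≤ ∑ i ∈ Finset.range n, t (rightEdge ((i : ℤ), 0)) ω := by
  rw [← restrictedTime_univ]
  simpa using restrictedTime_le_sum_right (F := Set.univ) (v := (0, 0)) (m := n)
    (fun e => ht.nonneg e ω) (by simp)

lemma strong_law (ht : IIDWeights P t) :
    ∀ᵐ ω ∂P, Tendsto (fun n : ℕ => (∑ i ∈ Finset.range n, t (rightEdge ((i : ℤ), 0)) ω) / n)
      atTop (𝓝 (meanWeight P t)) := by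
  have hinj : Function.Injective fun i : ℕ => rightEdge ((i : ℤ), 0) := fun i j h => by
    simpa using rightEdge_injective h
  have := strong_law_ae_real (μ := P) (fun (i : ℕ) => t (rightEdge ((i : ℤ), 0)))
    (ht.integrable _) (fun i j hij => ht.indep.indepFun (hinj.ne hij)) (fun i => ht.ident _ _)
  simpa [ht.integral_eq] using this

/-- Real `limsup` and `essSup` are meaningful only for bounded families. The straight path and the
strong law supply both bounds: `limsup a_n / n` is at most the mean weight. -/
lemma ae_eventually_pointToPoint_lt (ht : IIDWeights P t) {η : ℝ} (hη : 0 < η) :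
    ∀ᵐ ω ∂P, ∀ᶠ n : ℕ in atTop,
      pointToPoint (fun e => t e ω) n / n < timeConstant P t + η := by
  have hbdd : ∀ᵐ ω ∂P, IsBoundedUnder (· ≤ ·) atTop
      (fun n : ℕ => pointToPoint (fun e => t e ω) n / n) := by
    filter_upwards [ht.strong_law] with ω hω
    refine hω.isBoundedUnder_le.mono_le (.of_forall fun n => ?_)
    exact div_le_div_of_nonneg_right (ht.pointToPoint_le ω n) n.cast_nonneg
  have hess : ∀ᵐ ω ∂P, limsup (fun n : ℕ => pointToPoint (fun e => t e ω) n / n) atTop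
      ≤ timeConstant P t := by
    refine ae_le_essSup ⟨meanWeight P t, ?_⟩
    rw [eventually_map]
    filter_upwards [ht.strong_law] with ω hω
    rw [← hω.limsup_eq]
    refine limsup_le_limsup (.of_forall fun n => ?_) ?_ hω.isBoundedUnder_le
    · exact div_le_div_of_nonneg_right (ht.pointToPoint_le ω n) n.cast_nonneg
    · exact IsCoboundedUnder.of_frequently_ge (a := 0)
        (Frequently.of_forall fun n => div_nonneg (ht.pointToPoint_nonneg ω n) n.cast_nonneg)
  filter_upwards [hbdd, hess] with ω h1 h2
  exact eventually_lt_of_limsup_lt (h2.trans_lt (lt_add_of_pos_right _ hη)) h1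

lemma integrable_pointToPoint (ht : IIDWeights P t) (n : ℕ) :
    Integrable (fun ω => pointToPoint (fun e => t e ω) n) P := by
  simpa [restrictedTime_univ] using
    ht.integrable_restrictedTime (F := Set.univ) (v := (0, 0)) (m := n) (by simp)

/-- Fatou's lemma bounds means from below, so it is applied to the nonnegative variables `(S_n -
a_n)/n`, where `S_n` is the value of the straight path and has known mean. -/
lemma exists_integral_pointToPoint_le (ht : IIDWeights P t) {η : ℝ} (hη : 0 < η) :
    ∃ N : ℕ, 0 < N ∧
      ∫ ω, pointToPoint (fun e => t e ω) N ∂P ≤ (timeConstant P t + η) * N := by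
  set ν := timeConstant P t
  set μ := meanWeight P t
  -- If the mean weight is already small, one edge suffices. Otherwise `μ - (ν + η)` is positive,
  -- which makes the final comparison in `ENNReal` faithful.
  by_cases hc : μ ≤ ν + η
  · refine ⟨1, one_pos, ?_⟩
    have := ht.integral_restrictedTime_le_sum (F := Set.univ) (v := (0, 0)) (m := 1) (by simp)
    have h2 : ∀ w, restrictedTime Set.univ (0, 0) (1, 0) w = pointToPoint w 1 :=
      fun w => by simpa using restrictedTime_univ w 1
    simp [h2] at this
    simpa using this.trans hc
  push Not at hc
  set S : ℕ → Ω → ℝ := fun n ω => ∑ i ∈ Finset.range n, t (rightEdge ((i : ℤ), 0)) ω with hS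
  have hSint : ∀ n, Integrable (S n) P := fun n => by simpa using ht.integrable_sum (0, 0) n
  have hSE : ∀ n, ∫ ω, S n ω ∂P = n * μ := fun n => by simpa using ht.integral_sum (0, 0) n
  set f : ℕ → Ω → ℝ := fun n ω => (S n ω - pointToPoint (fun e => t e ω) n) / n with hf
  have hfint : ∀ n, Integrable (f n) P := fun n =>
    ((hSint n).sub (ht.integrable_pointToPoint n)).div_const _
  have hfnn : ∀ n ω, 0 ≤ f n ω := fun n ω =>
    div_nonneg (sub_nonneg.2 (ht.pointToPoint_le ω n)) n.cast_nonneg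
  by_contra! hcon
  have hub : ∀ n : ℕ, 0 < n → ∫ ω, f n ω ∂P ≤ μ - (ν + η) := by
    intro n hn
    have hn' : (0 : ℝ) < n := by exact_mod_cast hn
    rw [hf]
    simp only
    rw [integral_div, integral_sub (hSint n) (ht.integrable_pointToPoint n), hSE, div_le_iff₀ hn']
    have := hcon n hn
    nlinarith
  have hlow : ∀ᵐ ω ∂P, ENNReal.ofReal (μ - ν - η / 2) ≤
      liminf (fun n => ENNReal.ofReal (f n ω)) atTop := by
    filter_upwards [ht.strong_law, ht.ae_eventually_pointToPoint_lt (η := η / 4) (by linarith)]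
      with ω h1 h2
    refine le_liminf_of_le (by isBoundedDefault) ?_
    filter_upwards [h1.eventually (lt_mem_nhds (show μ - η / 4 < μ by linarith)), h2]
      with n h3 h4
    refine ENNReal.ofReal_le_ofReal ?_
    rw [hf]
    simp only [sub_div]
    linarith
  have h1 : ENNReal.ofReal (μ - ν - η / 2) ≤ ENNReal.ofReal (μ - (ν + η)) :=
    calc ENNReal.ofReal (μ - ν - η / 2)
        = ∫⁻ _, ENNReal.ofReal (μ - ν - η / 2) ∂P := by simp
      _ ≤ ∫⁻ ω, liminf (fun n => ENNReal.ofReal (f n ω)) atTop ∂P := lintegral_mono_ae hlow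
      _ ≤ liminf (fun n => ∫⁻ ω, ENNReal.ofReal (f n ω) ∂P) atTop :=
        lintegral_liminf_le' fun n => (hfint n).aestronglyMeasurable.aemeasurable.ennreal_ofReal
      _ ≤ ENNReal.ofReal (μ - (ν + η)) := by
        refine liminf_le_of_frequently_le' (Eventually.frequently ?_)
        filter_upwards [eventually_gt_atTop 0] with n hn
        rw [← ofReal_integral_eq_lintegral_ofReal (hfint n) (.of_forall (hfnn n))]
        exact ENNReal.ofReal_le_ofReal (hub n hn)
  rw [ENNReal.ofReal_le_ofReal_iff (by linarith)] at h1
  linarith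

end IIDWeights

/-! ### A finite box with small mean crossing time. -/

/-- The edges of the square `[-M, M]²`. -/
def squareEdges (M : ℕ) : Set (Sym2 (ℤ × ℤ)) :=
  {e | ∀ v ∈ e, |v.1| ≤ M ∧ |v.2| ≤ M}

/-- The edges of the box `[0, L] × [-M, M]`, without those of its left and right sides. -/
def boxEdges (L M : ℕ) : Set (Sym2 (ℤ × ℤ)) :=
  {e | (∀ v ∈ e, 0 ≤ v.1 ∧ v.1 ≤ L ∧ |v.2| ≤ M) ∧ (∃ v ∈ e, 0 < v.1) ∧ ∃ v ∈ e, v.1 < L}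

lemma rightEdge_mem_boxEdges {L M : ℕ} {a : ℤ} {m : ℕ} (ha : 0 ≤ a) (hm : a + m ≤ L) :
    ∀ i < m, (rightEdge ((a, 0) + ((i : ℤ), 0))).1 ∈ boxEdges L M := by
  intro i hi
  simp only [rightEdge, boxEdges, Set.mem_ofPred_eq, Sym2.mem_iff]
  refine ⟨?_, ⟨_, Or.inr rfl, ?_⟩, ⟨_, Or.inl rfl, ?_⟩⟩
  · rintro v (rfl | rfl) <;> simp <;> omega
  · simp; omega
  · simp; omega

lemma eventually_edges_subset_squareEdges {x y : ℤ × ℤ} (γ : latticeGraph.Walk x y) :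
    ∀ᶠ M in atTop, ∀ e ∈ γ.edges, e ∈ squareEdges M := by
  refine (γ.edges.finite_toSet.eventually_all).2 fun e _ => ?_
  induction e using Sym2.ind with
  | _ u v =>
    filter_upwards [eventually_ge_atTop
      (u.1.natAbs + u.2.natAbs + v.1.natAbs + v.2.natAbs)] with M hM
    simp only [squareEdges, Set.mem_ofPred_eq, Sym2.mem_iff]
    simp only [abs_le]
    rintro _ (rfl | rfl) <;> omega

lemma rightEdge_mem_squareEdges {N M : ℕ} (h : N ≤ M) :
    ∀ i < N, (rightEdge ((0, 0) + ((i : ℤ), 0))).1 ∈ squareEdges M := by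
  intro i hi
  simp only [rightEdge, squareEdges, Set.mem_ofPred_eq, Sym2.mem_iff]
  rintro v (rfl | rfl)
  · simp; omega
  · simp only [Prod.fst_add, Prod.snd_add]
    constructor <;> rw [abs_le] <;> omega

lemma shift_squareEdges {L M : ℕ} {a : ℤ} (h1 : M < a) (h2 : a + M < L) :
    ∀ e ∈ squareEdges M, Sym2.map (shift (a, 0)) e ∈ boxEdges L M := by
  intro e
  induction e using Sym2.ind with
  | _ u v =>
    intro h
    have hu := h u (by simp)
    have hv := h v (by simp)
    rw [abs_le] at hu hv
    simp only [boxEdges, Sym2.map_mk, Set.mem_ofPred_eq, Sym2.mem_iff, shift_apply]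
    refine ⟨?_, ⟨_, Or.inl rfl, ?_⟩, ⟨_, Or.inl rfl, ?_⟩⟩
    · rintro _ (rfl | rfl)
      · simp only [Prod.fst_add, Prod.snd_add]
        refine ⟨by omega, by omega, by simpa using hu.2⟩
      · simp only [Prod.fst_add, Prod.snd_add]
        refine ⟨by omega, by omega, by simpa using hv.2⟩
    · simp only [Prod.fst_add]; omega
    · simp only [Prod.fst_add]; omega

namespace IIDWeights

variable {Ω : Type*} [MeasurableSpace Ω] {P : Measure Ω} [IsProbabilityMeasure P]
  {t : Edge → Ω → ℝ}

/-- Every path is finite and so lies in some square; the restricted infima therefore converge to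
`a_N`. The straight path dominates them all. -/
lemma exists_integral_squareEdges_le (ht : IIDWeights P t) {η : ℝ} (hη : 0 < η) :
    ∃ N : ℕ, 0 < N ∧ ∃ M : ℕ, N ≤ M ∧
      ∫ ω, restrictedTime (squareEdges M) (0, 0) ((0, 0) + ((N : ℤ), 0)) (fun e => t e ω) ∂P
        ≤ (timeConstant P t + η) * N := by
  obtain ⟨N, hN, h⟩ := ht.exists_integral_pointToPoint_le (half_pos hη)
  refine ⟨N, hN, ?_⟩
  have hN' : (0 : ℝ) < N := by exact_mod_cast hN
  have hlim : Tendsto (fun M : ℕ => ∫ ω, restrictedTime (squareEdges M) (0, 0)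
      ((0, 0) + ((N : ℤ), 0)) (fun e => t e ω) ∂P) atTop
      (𝓝 (∫ ω, pointToPoint (fun e => t e ω) N ∂P)) := by
    refine tendsto_integral_filter_of_dominated_convergence
      (fun ω => ∑ i ∈ Finset.range N, t (rightEdge ((0, 0) + ((i : ℤ), 0))) ω)
      (.of_forall fun M =>
        (measurable_restrictedTime.comp ht.measurable_pi).aestronglyMeasurable) ?_
      (ht.integrable_sum _ _) (.of_forall fun ω => ?_)
    · filter_upwards [eventually_ge_atTop N] with M hM
      refine .of_forall fun ω => ?_
      rw [Real.norm_of_nonneg (restrictedTime_nonneg fun e => ht.nonneg e ω)]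
      exact restrictedTime_le_sum_right (fun e => ht.nonneg e ω) (rightEdge_mem_squareEdges hM)
    · have hnn : ∀ e, 0 ≤ t e ω := fun e => ht.nonneg e ω
      have he : ((0, 0) + ((N : ℤ), 0) : ℤ × ℤ) = ((N : ℤ), 0) := by simp
      rw [← restrictedTime_univ, he]
      refine tendsto_order.2 ⟨fun a ha => ?_, fun a ha => ?_⟩
      · filter_upwards [eventually_ge_atTop N] with M hM
        refine ha.trans_le (restrictedTime_mono hnn ?_ (Set.subset_univ _))
        rw [← he]
        exact joined_right (rightEdge_mem_squareEdges hM)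
      · have hj : Joined Set.univ (0, 0) ((N : ℤ), 0) := by
          rw [← he]
          exact joined_right (by simp)
        obtain ⟨γ, -, h2⟩ := exists_walk_of_restrictedTime_lt hj ha
        filter_upwards [eventually_edges_subset_squareEdges γ] with M hM
        exact (restrictedTime_le hnn γ hM).trans_lt h2
  have hlt : ∫ ω, pointToPoint (fun e => t e ω) N ∂P < (timeConstant P t + η) * N :=
    h.trans_lt (by gcongr; linarith)
  obtain ⟨M, h1, h2⟩ := ((hlim.eventually (gt_mem_nhds hlt)).and (eventually_ge_atTop N)).exists
  exact ⟨M, h2, h1.le⟩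

lemma integral_restrictedTime_add_le (ht : IIDWeights P t) {F : Set (Sym2 (ℤ × ℤ))} {a : ℤ}
    {m m' : ℕ} (h : ∀ i < m, (rightEdge ((a, 0) + ((i : ℤ), 0))).1 ∈ F)
    (h' : ∀ i < m', (rightEdge ((a + m, 0) + ((i : ℤ), 0))).1 ∈ F) :
    ∫ ω, restrictedTime F (a, 0) ((a, 0) + (((m + m' : ℕ) : ℤ), 0)) (fun e => t e ω) ∂P ≤
      ∫ ω, restrictedTime F (a, 0) ((a, 0) + ((m : ℤ), 0)) (fun e => t e ω) ∂P +
      ∫ ω, restrictedTime F (a + m, 0) ((a + m, 0) + ((m' : ℤ), 0)) (fun e => t e ω) ∂P := by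
  rw [← integral_add (ht.integrable_restrictedTime h) (ht.integrable_restrictedTime h')]
  have h1 : ((a, 0) + ((m : ℤ), 0) : ℤ × ℤ) = (a + m, 0) := by simp
  have h2 : ((a, 0) + (((m + m' : ℕ) : ℤ), 0) : ℤ × ℤ) = (a + m, 0) + ((m' : ℤ), 0) := by
    simp [add_assoc]
  refine integral_mono_of_nonneg
    (.of_forall fun ω => restrictedTime_nonneg fun e => ht.nonneg e ω)
    ((ht.integrable_restrictedTime h).add (ht.integrable_restrictedTime h'))
    (.of_forall fun ω => ?_)
  have j1 := joined_right h
  have j2 := joined_right h'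
  simp only [h1, h2] at j1 ⊢
  exact restrictedTime_triangle (fun e => ht.nonneg e ω) j1 j2

lemma integral_box_segment_le (ht : IIDWeights P t) {L M N : ℕ} {a : ℤ} (hNM : N ≤ M)
    (h1 : M < a) (h2 : a + M < L) :
    ∫ ω, restrictedTime (boxEdges L M) (a, 0) ((a, 0) + ((N : ℤ), 0)) (fun e => t e ω) ∂P ≤
      ∫ ω, restrictedTime (squareEdges M) (0, 0) ((0, 0) + ((N : ℤ), 0)) (fun e => t e ω) ∂P := by
  have hid := ht.identDistrib_comp
    (f := restrictedTime (squareEdges M) (0, 0) ((0, 0) + ((N : ℤ), 0)))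
    measurable_restrictedTime (shift (a, 0)).mapEdgeSet
  have hint := ht.integrable_restrictedTime (rightEdge_mem_squareEdges hNM)
  rw [← hid.integral_eq]
  refine integral_mono_of_nonneg
    (.of_forall fun ω => restrictedTime_nonneg fun e => ht.nonneg e ω)
    (hid.integrable_iff.2 hint) (.of_forall fun ω => ?_)
  have := restrictedTime_map_le (w := fun e => t e ω) (fun e => ht.nonneg e ω) (shift (a, 0))
    (joined_right (rightEdge_mem_squareEdges hNM)) (shift_squareEdges h1 h2)
  have e1 : shift (a, 0) (0, 0) = (a, 0) := by simp
  have e2 : shift (a, 0) ((0, 0) + ((N : ℤ), 0)) = (a, 0) + ((N : ℤ), 0) := by simp [add_comm]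
  rwa [e1, e2] at this

/-- `Q` translates of a cheap segment of length `N` are joined end to end. Straight ends of length
`M + 1` keep the translated squares strictly between the sides of the box, and their cost is
negligible for large `Q`. -/
lemma exists_integral_boxEdges_lt (ht : IIDWeights P t) {τ : ℝ} (hτ : timeConstant P t < τ) :
    ∃ L : ℕ, 0 < L ∧ ∃ M : ℕ,
      ∫ ω, restrictedTime (boxEdges L M) (0, 0) ((0, 0) + ((L : ℤ), 0)) (fun e => t e ω) ∂P
        < τ * L := by
  obtain ⟨σ, hσ1, hσ2⟩ := exists_between hτ
  obtain ⟨N, hN, M, hNM, h⟩ := ht.exists_integral_squareEdges_le (sub_pos.2 hσ1)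
  rw [add_sub_cancel] at h
  have hN' : (0 : ℝ) < N := by exact_mod_cast hN
  have hσ0 : 0 ≤ σ := by
    by_contra! hneg
    have : 0 ≤ σ * N := le_trans
      (integral_nonneg fun ω => restrictedTime_nonneg fun e => ht.nonneg e ω) h
    nlinarith
  -- The gain `(τ - σ)QN` has to exceed the mean cost of the two straight ends.
  obtain ⟨Q, hQ⟩ := exists_nat_gt ((2 * M + 2) * meanWeight P t / ((τ - σ) * N))
  rw [div_lt_iff₀ (mul_pos (sub_pos.2 hσ2) hN')] at hQ
  set L : ℕ := (M + 1) + Q * N + (M + 1) with hL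
  refine ⟨L, by omega, M, ?_⟩
  set F := boxEdges L M
  have hseg : ∀ q ≤ Q, ∫ ω, restrictedTime F (((M + 1 : ℕ) : ℤ), 0)
      ((((M + 1 : ℕ) : ℤ), 0) + (((q * N : ℕ) : ℤ), 0)) (fun e => t e ω) ∂P ≤ q * (σ * N) := by
    intro q
    induction q with
    | zero =>
      intro _
      have := ht.integral_restrictedTime_le_sum (F := F) (v := (((M + 1 : ℕ) : ℤ), 0)) (m := 0)
        (by simp)
      simpa using this
    | succ q ih =>
      intro hq
      have hqN : q * N + N ≤ Q * N := by
        rw [← Nat.succ_mul]; exact Nat.mul_le_mul_right _ hq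
      have hqN' : (q : ℤ) * N + N ≤ Q * N := by exact_mod_cast hqN
      have hq0 : (0 : ℤ) ≤ (q : ℤ) * N := by positivity
      rw [Nat.succ_mul]
      refine (ht.integral_restrictedTime_add_le
        (rightEdge_mem_boxEdges (by positivity) (by push_cast [hL]; omega))
        (rightEdge_mem_boxEdges (by positivity) (by push_cast [hL]; omega))).trans ?_
      have := ht.integral_box_segment_le (L := L) (a := ((M + 1 : ℕ) : ℤ) + ((q * N : ℕ) : ℤ)) hNM
        (by push_cast; omega) (by push_cast [hL]; omega)
      push_cast at this ih ⊢
      linarith [ih (by omega)]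
  have hQN0 : (0 : ℤ) ≤ (Q : ℤ) * N := by positivity
  have hmid : ∫ ω, restrictedTime F (((M + 1 : ℕ) : ℤ), 0)
      ((((M + 1 : ℕ) : ℤ), 0) + (((Q * N + (M + 1) : ℕ) : ℤ), 0)) (fun e => t e ω) ∂P
      ≤ Q * (σ * N) + ((M + 1 : ℕ) : ℝ) * meanWeight P t := by
    refine (ht.integral_restrictedTime_add_le
        (rightEdge_mem_boxEdges (by positivity) (by push_cast [hL]; omega))
        (rightEdge_mem_boxEdges (by positivity) (by push_cast [hL]; omega))).trans ?_
    exact add_le_add (hseg Q le_rfl) (ht.integral_restrictedTime_le_sum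
      (rightEdge_mem_boxEdges (by positivity) (by push_cast [hL]; omega)))
  have hall : ∫ ω, restrictedTime F (0, 0)
      ((0, 0) + (((M + 1 + (Q * N + (M + 1)) : ℕ) : ℤ), 0)) (fun e => t e ω) ∂P
      ≤ ((M + 1 : ℕ) : ℝ) * meanWeight P t +
        (Q * (σ * N) + ((M + 1 : ℕ) : ℝ) * meanWeight P t) := by
    refine (ht.integral_restrictedTime_add_le
        (rightEdge_mem_boxEdges (by positivity) (by push_cast [hL]; omega))
        (rightEdge_mem_boxEdges (by positivity) (by push_cast [hL]; omega))).trans ?_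
    refine add_le_add (ht.integral_restrictedTime_le_sum
      (rightEdge_mem_boxEdges (by positivity) (by push_cast [hL]; omega))) ?_
    simpa using hmid
  rw [← add_assoc, ← hL] at hall
  refine hall.trans_lt ?_
  have hM0 : 0 ≤ (2 * (M : ℝ) + 2) * τ := by
    have : 0 ≤ τ := hσ0.trans hσ2.le
    positivity
  have : (L : ℝ) = 2 * M + 2 + Q * N := by rw [hL]; push_cast; ring
  rw [this]
  push_cast
  nlinarith

end IIDWeights

/-! ### Exponential moments and large deviations. -/

/-- A random variable with negative mean, exponentially integrable near `0`, has moment generating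
function at most `1` to the right of `0`. -/
lemma eventually_mgf_le_one {Ω : Type*} [MeasurableSpace Ω] {P : Measure Ω}
    [IsProbabilityMeasure P] {Z : Ω → ℝ} (h0 : 0 ∈ interior (integrableExpSet Z P))
    (hneg : ∫ ω, Z ω ∂P < 0) : ∀ᶠ θ in 𝓝[>] (0 : ℝ), mgf Z P θ ≤ 1 := by
  -- The moment generating function equals `1` at `0` and its derivative there is the negative mean.
  have hd := hasDerivAt_mgf h0
  simp only [zero_mul, Real.exp_zero, mul_one] at hd
  have hs := (hasDerivAt_iff_tendsto_slope.1 hd).mono_left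
    (nhdsWithin_mono 0 fun θ (hθ : 0 < θ) => (ne_of_gt hθ : θ ≠ 0))
  filter_upwards [hs.eventually (gt_mem_nhds hneg), self_mem_nhdsWithin] with θ h1 (hθ : 0 < θ)
  rw [slope_def_field, sub_zero, mgf_zero, div_neg_iff] at h1
  rcases h1 with h1 | h1 <;> linarith [h1.1, h1.2]

namespace IIDWeights

variable {Ω : Type*} [MeasurableSpace Ω] {P : Measure Ω} [IsProbabilityMeasure P]
  {t : Edge → Ω → ℝ}

lemma indepFun_of_dependsOn (ht : IIDWeights P t) {S T : Finset Edge} (hST : Disjoint S T)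
    {f g : (Edge → ℝ) → ℝ} (hf : Measurable f) (hg : Measurable g)
    (hfS : DependsOn f (S : Set Edge)) (hgT : DependsOn g (T : Set Edge)) :
    IndepFun (fun ω => f fun e => t e ω) (fun ω => g fun e => t e ω) P := by
  classical
  -- Extending by zero factors `f` and `g` through the weights on `S` and `T`.
  have hext : ∀ S : Finset Edge, Measurable
      fun (u : S → ℝ) (e : Edge) => if h : e ∈ S then u ⟨e, h⟩ else 0 := by
    refine fun S => measurable_pi_lambda _ fun e => ?_
    by_cases h : e ∈ S
    · simpa [h] using measurable_pi_apply _
    · simp [h]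
  have key := (ht.indep.indepFun_finset S T hST ht.measurable).comp
    (hf.comp (hext S)) (hg.comp (hext T))
  refine key.congr (.of_forall fun ω => ?_) (.of_forall fun ω => ?_)
  · exact hfS fun e he => by simp [Finset.mem_coe.1 he]
  · exact hgT fun e he => by simp [Finset.mem_coe.1 he]

lemma mgf_sum_of_dependsOn {ι : Type*} (ht : IIDWeights P t) {f : ι → (Edge → ℝ) → ℝ}
    {S : ι → Finset Edge} (hS : Pairwise (Function.onFun Disjoint S))
    (hf : ∀ i, Measurable (f i)) (hfS : ∀ i, DependsOn (f i) (S i : Set Edge)) {θ : ℝ}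
    (hint : ∀ i, Integrable (fun ω => Real.exp (θ * f i fun e => t e ω)) P) (A : Finset ι) :
    Integrable (fun ω => Real.exp (θ * ∑ i ∈ A, f i fun e => t e ω)) P ∧
    mgf (fun ω => ∑ i ∈ A, f i fun e => t e ω) P θ
      = ∏ i ∈ A, mgf (fun ω => f i fun e => t e ω) P θ := by
  classical
  induction A using Finset.induction_on with
  | empty => simp [mgf]
  | insert i A hi ih =>
    have hdisj : Disjoint (S i) (A.biUnion S) := by
      rw [Finset.disjoint_biUnion_right]
      exact fun j hj => hS fun h => hi (h ▸ hj)
    have hind : IndepFun (fun ω => f i fun e => t e ω)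
        (fun ω => ∑ j ∈ A, f j fun e => t e ω) P := by
      refine ht.indepFun_of_dependsOn hdisj (hf i)
        (g := fun w => ∑ j ∈ A, f j w) (Finset.measurable_sum _ fun j _ => hf j) (hfS i) ?_
      intro x y hxy
      exact Finset.sum_congr rfl fun j hj => hfS j fun e he =>
        hxy e (Finset.mem_coe.2 (Finset.mem_biUnion.2 ⟨j, hj, he⟩))
    simp only [Finset.sum_insert hi, Finset.prod_insert hi]
    rw [← ih.2]
    exact ⟨hind.integrable_exp_mul_add (hint i) ih.1,
      hind.mgf_add (hint i).aestronglyMeasurable ih.1.aestronglyMeasurable⟩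

lemma integrable_exp_mul_of_le (ht : IIDWeights P t) {θ c : ℝ} (hc : θ ≤ c)
    (hint : ∀ e, Integrable (fun ω => Real.exp (c * t e ω)) P) (e : Edge) :
    Integrable (fun ω => Real.exp (θ * t e ω)) P := by
  refine (hint e).mono' (by have := ht.measurable e; fun_prop) (.of_forall fun ω => ?_)
  rw [Real.norm_of_nonneg (Real.exp_nonneg _)]
  have := ht.nonneg e ω
  gcongr

lemma mgf_eq (ht : IIDWeights P t) (e : Edge) (θ : ℝ) :
    mgf (t e) P θ = mgf (t (rightEdge (0, 0))) P θ :=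
  congrFun (mgf_congr_identDistrib (ht.ident _ _)) θ

lemma one_le_mgf (ht : IIDWeights P t) {θ : ℝ} (hθ : 0 ≤ θ) (e : Edge)
    (hint : Integrable (fun ω => Real.exp (θ * t e ω)) P) : 1 ≤ mgf (t e) P θ := by
  have : ∫ _, (1 : ℝ) ∂P ≤ mgf (t e) P θ := integral_mono (integrable_const _) hint fun ω =>
    Real.one_le_exp (mul_nonneg hθ (ht.nonneg e ω))
  simpa using this

/-- The restricted time lies between `0` and the value of the straight path: the lower bound handles
`θ ≤ 0`, the upper bound `0 ≤ θ < c`. -/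
lemma zero_mem_interior_integrableExpSet (ht : IIDWeights P t) {L : ℕ}
    {F : Set (Sym2 (ℤ × ℤ))} {v : ℤ × ℤ} (h : ∀ i < L, (rightEdge (v + ((i : ℤ), 0))).1 ∈ F)
    (r : ℝ) : 0 ∈ interior (integrableExpSet
      (fun ω => restrictedTime F v (v + ((L : ℤ), 0)) (fun e => t e ω) - r) P) := by
  obtain ⟨c, hc, hint⟩ := ht.exp_moment
  rw [mem_interior]
  refine ⟨Set.Ioo (-1) c, fun θ hθ => ?_, isOpen_Ioo, by simp [hc]⟩
  have hmeas : Measurable fun ω => restrictedTime F v (v + ((L : ℤ), 0)) (fun e => t e ω) :=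
    measurable_restrictedTime.comp ht.measurable_pi
  have hinj : Function.Injective fun i : ℕ => rightEdge (v + ((i : ℤ), 0)) := fun i j h => by
    simpa using rightEdge_injective h
  have hsum := (ht.indep.precomp hinj).integrable_exp_mul_sum (t := c) (s := Finset.range L)
    (fun i => ht.measurable _) fun i _ => hint _
  have key : Integrable (fun ω => Real.exp
      (θ * restrictedTime F v (v + ((L : ℤ), 0)) fun e => t e ω)) P := by
    refine (hsum.add (integrable_const 1)).mono'
      (hmeas.const_mul θ).exp.aestronglyMeasurable (.of_forall fun ω => ?_)
    have h0 : 0 ≤ restrictedTime F v (v + ((L : ℤ), 0)) fun e => t e ω :=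
      restrictedTime_nonneg fun e => ht.nonneg e ω
    have h1 := restrictedTime_le_sum_right (w := fun e => t e ω) (fun e => ht.nonneg e ω) h
    rw [Real.norm_of_nonneg (Real.exp_nonneg _)]
    simp only [Pi.add_apply, Finset.sum_apply]
    rcases le_total θ 0 with h2 | h2
    · have : Real.exp (θ * restrictedTime F v (v + ((L : ℤ), 0)) fun e => t e ω) ≤ 1 :=
        Real.exp_le_one_iff.2 (mul_nonpos_of_nonpos_of_nonneg h2 h0)
      have := Real.exp_nonneg
        (c * ∑ i ∈ Finset.range L, t (rightEdge (v + ((i : ℤ), 0))) ω)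
      linarith
    · have : Real.exp (θ * restrictedTime F v (v + ((L : ℤ), 0)) fun e => t e ω) ≤
          Real.exp (c * ∑ i ∈ Finset.range L, t (rightEdge (v + ((i : ℤ), 0))) ω) :=
        Real.exp_le_exp.2 (mul_le_mul hθ.2.le h1 h0 hc.le)
      linarith
  show Integrable _ P
  simpa [mul_sub, Real.exp_sub] using key.div_const (Real.exp (θ * r))

/-- Chernoff bound for many simultaneous large deviations, with a union bound over the set of
indices at which they occur. -/
lemma prob_many_large_le {κ : Type*} [Fintype κ] (ht : IIDWeights P t)
    {f : ℕ → κ → (Edge → ℝ) → ℝ} {S : ℕ → κ → Finset Edge}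
    (hS : Pairwise (Function.onFun Disjoint fun i : ℕ × κ => S i.1 i.2))
    (hf : ∀ k o, Measurable (f k o)) (hfS : ∀ k o, DependsOn (f k o) (S k o : Set Edge))
    {θ C u ρ : ℝ} (hθ : 0 ≤ θ)
    (hint : ∀ k o, Integrable (fun ω => Real.exp (θ * f k o fun e => t e ω)) P)
    (hC : ∀ k, ∏ o, mgf (fun ω => f k o fun e => t e ω) P θ ≤ C) (hρ : 0 ≤ ρ)
    (hCρ : C * Real.exp (-(θ * u)) ≤ Real.exp (-ρ)) (K : ℕ) (m : ℝ) :
    P.real {ω | ∃ A ⊆ Finset.range K, m ≤ A.card ∧ ∀ k ∈ A, u ≤ ∑ o, f k o fun e => t e ω}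
      ≤ 2 ^ K * Real.exp (-(ρ * m)) := by
  classical
  -- For a fixed `A`, Chernoff's bound is applied once, to the sum over all of `A`; independence
  -- makes the bound a product over `A`.
  have hone : ∀ A : Finset ℕ, P.real {ω | ∀ k ∈ A, u ≤ ∑ o, f k o fun e => t e ω}
      ≤ Real.exp (-(ρ * A.card)) := by
    intro A
    obtain ⟨h1, h2⟩ := ht.mgf_sum_of_dependsOn (ι := ℕ × κ) (f := fun i => f i.1 i.2) hS
      (fun i => hf _ _) (fun i => hfS _ _) (fun i => hint i.1 i.2) (A ×ˢ Finset.univ)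
    simp only [Finset.sum_product, Finset.prod_product] at h1 h2
    calc P.real {ω | ∀ k ∈ A, u ≤ ∑ o, f k o fun e => t e ω}
        ≤ P.real {ω | A.card * u ≤ ∑ k ∈ A, ∑ o, f k o fun e => t e ω} := by
          refine measureReal_mono fun ω hω => ?_
          have := Finset.card_nsmul_le_sum A (fun k => ∑ o, f k o fun e => t e ω) u hω
          simpa using this
      _ ≤ Real.exp (-θ * (A.card * u)) *
            mgf (fun ω => ∑ k ∈ A, ∑ o, f k o fun e => t e ω) P θ :=
          measure_ge_le_exp_mul_mgf _ hθ h1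
      _ = ∏ k ∈ A, (Real.exp (-(θ * u)) * ∏ o, mgf (fun ω => f k o fun e => t e ω) P θ) := by
          rw [h2, Finset.prod_mul_distrib, Finset.prod_const, ← Real.exp_nat_mul]
          congr 2
          ring
      _ ≤ ∏ _k ∈ A, Real.exp (-ρ) := by
          refine Finset.prod_le_prod (fun k _ => ?_) fun k _ => ?_
          · exact mul_nonneg (Real.exp_nonneg _) (Finset.prod_nonneg fun o _ => mgf_nonneg)
          · refine le_trans ?_ hCρ
            rw [mul_comm]
            exact mul_le_mul_of_nonneg_right (hC k) (Real.exp_nonneg _)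
      _ = Real.exp (-(ρ * A.card)) := by
          rw [Finset.prod_const, ← Real.exp_nat_mul]
          congr 1
          ring
  set Q := (Finset.range K).powerset.filter fun A => m ≤ A.card with hQ
  calc P.real {ω | ∃ A ⊆ Finset.range K, m ≤ A.card ∧ ∀ k ∈ A, u ≤ ∑ o, f k o fun e => t e ω}
      ≤ P.real (⋃ A ∈ Q, {ω | ∀ k ∈ A, u ≤ ∑ o, f k o fun e => t e ω}) := by
        refine measureReal_mono (fun ω ⟨A, h1, h2, h3⟩ => ?_) (measure_ne_top _ _)
        simp only [Set.mem_iUnion]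
        exact ⟨A, Finset.mem_filter.2 ⟨Finset.mem_powerset.2 h1, h2⟩, h3⟩
    _ ≤ ∑ A ∈ Q, P.real {ω | ∀ k ∈ A, u ≤ ∑ o, f k o fun e => t e ω} :=
        measureReal_biUnion_finset_le _ _
    _ ≤ ∑ _A ∈ Q, Real.exp (-(ρ * m)) := by
        refine Finset.sum_le_sum fun A hA => (hone A).trans ?_
        have := (Finset.mem_filter.1 hA).2
        gcongr
    _ ≤ 2 ^ K * Real.exp (-(ρ * m)) := by
        rw [Finset.sum_const, nsmul_eq_mul]
        refine mul_le_mul_of_nonneg_right ?_ (Real.exp_nonneg _)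
        have : Q.card ≤ 2 ^ K := (Finset.card_filter_le _ _).trans (by simp)
        exact_mod_cast this

end IIDWeights

/-! ### Deterministic crossing of a channel. -/

section Symmetry

variable {w : Edge → ℝ} {x y : ℤ × ℤ} {F : Set (Sym2 (ℤ × ℤ))}

lemma Joined.symm (h : Joined F x y) : Joined F y x := by
  obtain ⟨γ, hγ⟩ := h
  exact ⟨γ.reverse, fun e he => hγ e (by simpa using he)⟩

lemma Joined.refl (F : Set (Sym2 (ℤ × ℤ))) (x : ℤ × ℤ) : Joined F x x :=
  ⟨.nil, by simp⟩

lemma restrictedTime_self (hw : ∀ e, 0 ≤ w e) : restrictedTime F x x w = 0 :=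
  le_antisymm (restrictedTime_le (F := F) hw (.nil : latticeGraph.Walk x x) (by simp))
    (restrictedTime_nonneg hw)

lemma restrictedTime_symm_le (hw : ∀ e, 0 ≤ w e) (h : Joined F x y) :
    restrictedTime F y x w ≤ restrictedTime F x y w := by
  refine le_of_forall_pos_le_add fun ε hε => ?_
  obtain ⟨γ, hγ, hγ1⟩ := exists_walk_of_restrictedTime_lt (w := w) h
    (lt_add_of_pos_right _ hε)
  have := restrictedTime_le (F := F) hw γ.reverse fun e he => hγ e (by simpa using he)
  rw [passageTime_reverse] at this
  linarith

end Symmetry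

/-- The edges between vertices whose first coordinate lies in `[a, b]`. -/
def stripEdges (a b : ℤ) : Set (Sym2 (ℤ × ℤ)) := {e | ∀ v ∈ e, a ≤ v.1 ∧ v.1 ≤ b}

/-- The lattice automorphism that exchanges the coordinates and then translates by `(a, b)`. -/
def turn (a b : ℤ) : latticeGraph ≃g latticeGraph := swap.trans (shift (a, b))

@[simp] lemma turn_apply (a b : ℤ) (v : ℤ × ℤ) : turn a b v = (v.2 + a, v.1 + b) := rfl

lemma sum_le_sum_of_injective {w : Edge → ℝ} (hw : ∀ e, 0 ≤ w e) {g : ℕ → Edge}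
    (hg : Function.Injective g) {m : ℕ} {R : Finset Edge} (hR : ∀ i < m, g i ∈ R) :
    ∑ i ∈ Finset.range m, w (g i) ≤ ∑ e ∈ R, w e := by
  classical
  rw [← Finset.sum_image (f := w) (g := g) (hg.injOn)]
  refine Finset.sum_le_sum_of_subset_of_nonneg ?_ fun e _ _ => hw e
  intro e he
  obtain ⟨i, hi, rfl⟩ := Finset.mem_image.1 he
  exact hR i (Finset.mem_range.1 hi)

open Classical in
/-- The `l` horizontal edges to the right of `(a, h)`, the `l` horizontal edges to the right of
`(a, h')` and the `L` vertical edges above `(x, y)`. -/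
noncomputable def connectorEdges (a h h' x y : ℤ) (l L : ℕ) : Finset Edge :=
  (Finset.range l).image (fun i : ℕ => rightEdge (a + (i : ℤ), h)) ∪
    (Finset.range l).image (fun i : ℕ => rightEdge (a + (i : ℤ), h')) ∪
    (Finset.range L).image (fun i : ℕ => upEdge (x, y + (i : ℤ)))

lemma card_connectorEdges_le (a h h' x y : ℤ) (l L : ℕ) :
    (connectorEdges a h h' x y l L).card ≤ 2 * l + L := by
  classical
  refine (Finset.card_union_le _ _).trans (add_le_add ((Finset.card_union_le _ _).trans ?_)
    (Finset.card_image_le.trans (by simp)))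
  rw [two_mul]
  exact add_le_add (Finset.card_image_le.trans (by simp)) (Finset.card_image_le.trans (by simp))

section Connect

variable {w : Edge → ℝ} {a b : ℤ} {R : Finset Edge}

lemma row_connection (hw : ∀ e, 0 ≤ w e) {h : ℤ}
    (hR : ∀ z, a ≤ z → z < b → rightEdge (z, h) ∈ R) {p q : ℤ} (hp : a ≤ p) (hp' : p ≤ b)
    (hq : a ≤ q) (hq' : q ≤ b) :
    Joined (stripEdges a b) (p, h) (q, h) ∧
      restrictedTime (stripEdges a b) (p, h) (q, h) w ≤ ∑ e ∈ R, w e := by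
  have main : ∀ p q : ℤ, a ≤ p → q ≤ b → p ≤ q → Joined (stripEdges a b) (p, h) (q, h) ∧
      restrictedTime (stripEdges a b) (p, h) (q, h) w ≤ ∑ e ∈ R, w e := by
    intro p q hp hq hpq
    obtain ⟨m, rfl⟩ := Int.le.dest hpq
    have hmem : ∀ i < m, (rightEdge ((p, h) + ((i : ℤ), 0))).1 ∈ stripEdges a b := by
      intro i hi
      simp only [rightEdge, stripEdges, Set.mem_ofPred_eq, Sym2.mem_iff]
      rintro _ (rfl | rfl) <;> simp <;> omega
    have he : ((p, h) + ((m : ℤ), 0) : ℤ × ℤ) = (p + m, h) := by simp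
    rw [← he]
    refine ⟨joined_right hmem, (restrictedTime_le_sum_right hw hmem).trans
      (sum_le_sum_of_injective hw (g := fun i : ℕ => rightEdge ((p, h) + ((i : ℤ), 0)))
        (fun i j hij => by simpa using rightEdge_injective hij) fun i hi => ?_)⟩
    simpa using hR (p + i) (by omega) (by omega)
  rcases le_total p q with hpq | hpq
  · exact main p q hp hq' hpq
  · obtain ⟨h1, h2⟩ := main q p hq hp' hpq
    exact ⟨h1.symm, (restrictedTime_symm_le hw h1).trans h2⟩

lemma column_connection (hw : ∀ e, 0 ≤ w e) {x y y' : ℤ} (hx : a ≤ x) (hx' : x ≤ b)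
    (hy : y ≤ y') (hR : ∀ z, y ≤ z → z < y' → upEdge (x, z) ∈ R) :
    Joined (stripEdges a b) (x, y) (x, y') ∧
      restrictedTime (stripEdges a b) (x, y) (x, y') w ≤ ∑ e ∈ R, w e := by
  obtain ⟨m, rfl⟩ := Int.le.dest hy
  obtain ⟨γ, h1, h2⟩ := exists_walk_up w (x, y) m
  have he : ((x, y) + (0, (m : ℤ)) : ℤ × ℤ) = (x, y + m) := by simp
  rw [← he]
  have hγ : ∀ e ∈ γ.edges, e ∈ stripEdges a b := by
    intro e he
    obtain ⟨i, hi, rfl⟩ := h1 e he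
    simp only [upEdge, stripEdges, Set.mem_ofPred_eq, Sym2.mem_iff]
    rintro _ (rfl | rfl) <;> simp <;> omega
  refine ⟨⟨γ, hγ⟩, (restrictedTime_le hw γ hγ).trans ?_⟩
  rw [h2]
  refine sum_le_sum_of_injective hw (g := fun i : ℕ => upEdge ((x, y) + (0, (i : ℤ))))
    (fun i j hij => by simpa using upEdge_injective hij) fun i hi => ?_
  simpa using hR (y + i) (by omega) (by omega)

lemma tower_connection (hw : ∀ e, 0 ≤ w e) {x h : ℤ} {L M : ℕ} (hx : a ≤ x - M)
    (hx' : x + M ≤ b) (J : ℕ) :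
    Joined (stripEdges a b) (x, h) (x, h + (J * L : ℕ)) ∧
      restrictedTime (stripEdges a b) (x, h) (x, h + (J * L : ℕ)) w ≤
        ∑ j ∈ Finset.range J, restrictedTime (boxEdges L M) (0, 0) ((0, 0) + ((L : ℤ), 0))
          fun e => w ((turn x (h + (j * L : ℕ))).mapEdgeSet e) := by
  induction J with
  | zero => simp [Joined.refl, restrictedTime_self hw]
  | succ J ih =>
    have hbox : Joined (boxEdges L M) (0, 0) ((0, 0) + ((L : ℤ), 0)) :=
      joined_right (rightEdge_mem_boxEdges le_rfl (by omega))
    have hmap : ∀ e ∈ boxEdges L M, Sym2.map (turn x (h + (J * L : ℕ))) e ∈ stripEdges a b := by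
      intro e he v hv
      obtain ⟨u, hu, rfl⟩ := Sym2.mem_map.1 hv
      have := abs_le.1 (he.1 u hu).2.2
      rw [turn_apply]
      constructor <;> simp only <;> omega
    have h1 := hbox.map _ hmap
    have h2 := restrictedTime_map_le hw _ hbox hmap
    have e1 : turn x (h + (J * L : ℕ)) (0, 0) = (x, h + (J * L : ℕ)) := by simp
    have e2 : turn x (h + (J * L : ℕ)) ((0, 0) + ((L : ℤ), 0))
        = (x, h + ((J + 1) * L : ℕ)) := by simp; ring
    rw [e1, e2] at h1 h2
    refine ⟨ih.1.trans h1, (restrictedTime_triangle hw ih.1 h1).trans ?_⟩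
    rw [Finset.sum_range_succ]
    exact add_le_add ih.2 h2

/-- The route is a row at height `h`, the tower of boxes on the column `a + M`, the rest of that
column, and a row at height `h'`. The three connecting parts are each bounded by the whole connector
sum, whence the factor `3` and a bound that serves all `p` and `q` at once. -/
lemma strip_connection (hw : ∀ e, 0 ≤ w e) {h h' : ℤ} {l L M J : ℕ} (hMl : 2 * M + 1 ≤ l)
    (hb : a + l - 1 ≤ b) (hb' : b ≤ a + l) (hJ : h + (J * L : ℕ) ≤ h')
    (hJ' : h' < h + (J * L : ℕ) + L) {p q : ℤ} (hp : a ≤ p) (hp' : p ≤ b) (hq : a ≤ q)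
    (hq' : q ≤ b) :
    Joined (stripEdges a b) (p, h) (q, h') ∧
      restrictedTime (stripEdges a b) (p, h) (q, h') w ≤
        ∑ j ∈ Finset.range J, restrictedTime (boxEdges L M) (0, 0) ((0, 0) + ((L : ℤ), 0))
          (fun e => w ((turn (a + M) (h + (j * L : ℕ))).mapEdgeSet e)) +
        3 * ∑ e ∈ connectorEdges a h h' (a + M) (h + (J * L : ℕ)) l L, w e := by
  classical
  set R := connectorEdges a h h' (a + M) (h + (J * L : ℕ)) l L with hR
  have hR1 : ∀ z, a ≤ z → z < b → rightEdge (z, h) ∈ R := fun z h1 h2 => by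
    simp only [hR, connectorEdges, Finset.mem_union, Finset.mem_image, Finset.mem_range]
    exact Or.inl (Or.inl ⟨(z - a).toNat, by omega, by congr 2; omega⟩)
  have hR2 : ∀ z, a ≤ z → z < b → rightEdge (z, h') ∈ R := fun z h1 h2 => by
    simp only [hR, connectorEdges, Finset.mem_union, Finset.mem_image, Finset.mem_range]
    exact Or.inl (Or.inr ⟨(z - a).toNat, by omega, by congr 2; omega⟩)
  have hR3 : ∀ z, h + (J * L : ℕ) ≤ z → z < h' → upEdge (a + M, z) ∈ R := fun z h1 h2 => by
    simp only [hR, connectorEdges, Finset.mem_union, Finset.mem_image, Finset.mem_range]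
    exact Or.inr ⟨(z - (h + (J * L : ℕ))).toNat, by omega, by congr 2; omega⟩
  obtain ⟨j1, d1⟩ := row_connection hw hR1 hp hp' (q := a + M) (by omega) (by omega)
  obtain ⟨j2, d2⟩ := tower_connection (a := a) (b := b) hw (x := a + M) (h := h) (L := L) (M := M)
    (by omega) (by omega) J
  obtain ⟨j3, d3⟩ := column_connection (a := a) (b := b) hw (x := a + M) (by omega) (by omega)
    hJ hR3
  obtain ⟨j4, d4⟩ := row_connection hw hR2 (p := a + M) (by omega) (by omega) hq hq'
  refine ⟨((j1.trans j2).trans j3).trans j4, ?_⟩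
  have t1 := restrictedTime_triangle hw j1 j2
  have t2 := restrictedTime_triangle hw (j1.trans j2) j3
  have t3 := restrictedTime_triangle hw ((j1.trans j2).trans j3) j4
  linarith

end Connect

lemma mem_channelBase {δ : ℝ} {n l k : ℕ} {z : ℤ} : z ∈ channelBase δ n l k ↔
    ⌈-(δ * n)⌉ + k * l ≤ z ∧ z ≤ ⌊-(δ * n)⌋ + (k + 1) * l := by
  have h1 : ⌈-(δ * n)⌉ + k * l ≤ z ↔ -(δ * n) + k * l ≤ (z : ℝ) := by
    rw [← le_sub_iff_add_le, Int.ceil_le, ← le_sub_iff_add_le]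
    push_cast; rfl
  have h2 : z ≤ ⌊-(δ * n)⌋ + (k + 1) * l ↔ (z : ℝ) ≤ -(δ * n) + (k + 1) * l := by
    rw [← sub_le_iff_le_add, Int.le_floor, ← sub_le_iff_le_add]
    push_cast; rfl
  rw [h1, h2]
  rfl

lemma goodChannel_of_lt {w : Edge → ℝ} (hw : ∀ e, 0 ≤ w e) {ν ε δ : ℝ} {n l k L M J : ℕ}
    (hMl : 2 * M + 1 ≤ l) (hJ : ⌊δ * n⌋ + (J * L : ℕ) ≤ ⌊(1 - δ) * n⌋)
    (hJ' : ⌊(1 - δ) * n⌋ < ⌊δ * n⌋ + (J * L : ℕ) + L)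
    (hlt : ∑ j ∈ Finset.range J, restrictedTime (boxEdges L M) (0, 0) ((0, 0) + ((L : ℤ), 0))
          (fun e => w ((turn (⌈-(δ * n)⌉ + k * l + M) (⌊δ * n⌋ + (j * L : ℕ))).mapEdgeSet e)) +
        3 * ∑ e ∈ connectorEdges (⌈-(δ * n)⌉ + k * l) ⌊δ * n⌋ ⌊(1 - δ) * n⌋
          (⌈-(δ * n)⌉ + k * l + M) (⌊δ * n⌋ + (J * L : ℕ)) l L, w e
        < (ν + ε / 5) * (1 - 2 * δ) * n) :
    GoodChannel w ν ε δ n l k := by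
  intro p hp q hq
  rw [mem_channelBase] at hp hq
  -- The channel has `l + 1` columns if `δn` is an integer, and `l` otherwise.
  have hcf : ⌈-(δ * n)⌉ ≤ ⌊-(δ * n)⌋ + 1 := Int.ceil_le_floor_add_one _
  have hfc : ⌊-(δ * n)⌋ ≤ ⌈-(δ * n)⌉ := Int.floor_le_ceil _
  have hkl : ((k : ℤ) + 1) * l = k * l + l := by ring
  obtain ⟨h1, h2⟩ := strip_connection hw (M := M) (l := l)
    (a := ⌈-(δ * n)⌉ + k * l) (b := ⌊-(δ * n)⌋ + (k + 1) * l) hMl (by omega) (by omega) hJ hJ'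
    hp.1 hp.2 hq.1 hq.2
  obtain ⟨γ, h3, h4⟩ := exists_walk_of_restrictedTime_lt h1 (h2.trans_lt hlt)
  refine ⟨γ, fun v hv => ?_, h4.le⟩
  rw [mem_channelBase]
  rw [SimpleGraph.Walk.mem_support_iff_exists_mem_edges] at hv
  rcases hv with rfl | ⟨e, he, hve⟩
  · exact hq
  · exact h3 e he v hve

lemma finite_boxEdges (L M : ℕ) : {e : Edge | e.1 ∈ boxEdges L M}.Finite := by
  refine Set.Finite.preimage Subtype.val_injective.injOn
    ((((Set.finite_Icc ((0 : ℤ), -(M : ℤ)) ((L : ℤ), (M : ℤ))).prod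
      (Set.finite_Icc ((0 : ℤ), -(M : ℤ)) ((L : ℤ), (M : ℤ)))).image
        fun p => s(p.1, p.2)).subset fun e => ?_)
  induction e using Sym2.ind with
  | _ u v =>
    intro h
    have hu := h.1 u (by simp)
    have hv := h.1 v (by simp)
    rw [abs_le] at hu hv
    exact ⟨(u, v), ⟨⟨⟨hu.1, hu.2.2.1⟩, ⟨hu.2.1, hu.2.2.2⟩⟩, ⟨⟨hv.1, hv.2.2.1⟩, ⟨hv.2.1, hv.2.2.2⟩⟩⟩,
      rfl⟩

/-! ### Disjointness of the pieces of the channels. -/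

/-- The edges used to cross the channel of width `l` to the right of `a` between the heights `h`
and `h'`: those of `J` stacked boxes of height `L`, and the edges connecting them to the ends. -/
noncomputable def channelPiece (a h h' : ℤ) (l L M : ℕ) {J : ℕ} : Option (Fin J) → Finset Edge
  | none => connectorEdges a h h' (a + M) (h + (J * L : ℕ)) l L
  | some j => (finite_boxEdges L M).toFinset.map
      (turn (a + M) (h + (j * L : ℕ))).mapEdgeSet.toEmbedding

/-- The cost of crossing the pieces of a channel, where each box is credited with `τ` per unit of
its height. -/
noncomputable def channelCost (τ : ℝ) (a h h' : ℤ) (l L M : ℕ) {J : ℕ} :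
    Option (Fin J) → (Edge → ℝ) → ℝ
  | none => fun w => 3 * ∑ e ∈ connectorEdges a h h' (a + M) (h + (J * L : ℕ)) l L, w e
  | some j => fun w => restrictedTime (boxEdges L M) (0, 0) ((0, 0) + ((L : ℤ), 0))
      (fun e => w ((turn (a + M) (h + (j * L : ℕ))).mapEdgeSet e)) - τ * L

section Pieces

variable {τ : ℝ} {a h h' : ℤ} {l L M J : ℕ}

lemma measurable_channelCost (o : Option (Fin J)) :
    Measurable (channelCost τ a h h' l L M o) := by
  cases o with
  | none =>
    exact (Finset.measurable_sum _ fun e _ => measurable_pi_apply e).const_mul 3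
  | some j =>
    refine (measurable_restrictedTime.comp ?_).sub_const _
    exact measurable_pi_lambda _ fun e => measurable_pi_apply _

lemma dependsOn_channelCost (o : Option (Fin J)) :
    DependsOn (channelCost τ a h h' l L M o) (channelPiece a h h' l L M o : Set Edge) := by
  intro w w' hw
  cases o with
  | none =>
    exact congrArg (3 * ·) (Finset.sum_congr rfl fun e he => hw e (Finset.mem_coe.2 he))
  | some j =>
    simp only [channelCost]
    rw [restrictedTime_congr fun e he => hw _ ?_]
    exact Finset.mem_coe.2 (Finset.mem_map.2
      ⟨e, (finite_boxEdges L M).mem_toFinset.2 he, rfl⟩)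

lemma sum_channelCost (w : Edge → ℝ) :
    ∑ o : Option (Fin J), channelCost τ a h h' l L M o w =
      ∑ j ∈ Finset.range J, restrictedTime (boxEdges L M) (0, 0) ((0, 0) + ((L : ℤ), 0))
        (fun e => w ((turn (a + M) (h + (j * L : ℕ))).mapEdgeSet e)) +
      3 * ∑ e ∈ connectorEdges a h h' (a + M) (h + (J * L : ℕ)) l L, w e - τ * (J * L) := by
  rw [Fintype.sum_option]
  simp only [channelCost, Finset.sum_sub_distrib]
  rw [Fin.sum_univ_eq_sum_range fun j => restrictedTime (boxEdges L M) (0, 0)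
    ((0, 0) + ((L : ℤ), 0)) fun e => w ((turn (a + M) (h + (j * L : ℕ))).mapEdgeSet e)]
  simp
  ring

lemma mem_channelPiece_none {e : Edge}
    (he : e ∈ channelPiece a h h' l L M (none : Option (Fin J))) :
    (∃ i < l, e = rightEdge (a + (i : ℤ), h)) ∨ (∃ i < l, e = rightEdge (a + (i : ℤ), h')) ∨
      ∃ i < L, e = upEdge (a + M, h + (J * L : ℕ) + (i : ℤ)) := by
  classical
  simp only [channelPiece, connectorEdges, Finset.mem_union, Finset.mem_image,
    Finset.mem_range] at he
  rcases he with (⟨i, hi, rfl⟩ | ⟨i, hi, rfl⟩) | ⟨i, hi, rfl⟩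
  · exact Or.inl ⟨i, hi, rfl⟩
  · exact Or.inr (Or.inl ⟨i, hi, rfl⟩)
  · exact Or.inr (Or.inr ⟨i, hi, rfl⟩)

lemma mem_channelPiece_some {e : Edge} {j : Fin J}
    (he : e ∈ channelPiece a h h' l L M (some j)) :
    (∀ v ∈ e.1, a ≤ v.1 ∧ v.1 ≤ a + 2 * M ∧ h + (j * L : ℕ) ≤ v.2) ∧
      (∃ v ∈ e.1, h + (j * L : ℕ) < v.2) ∧ ∃ v ∈ e.1, v.2 < h + (j * L : ℕ) + L := by
  simp only [channelPiece, Finset.mem_map, Set.Finite.mem_toFinset] at he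
  obtain ⟨e', ⟨h1, ⟨v, hv, hv'⟩, ⟨u, hu, hu'⟩⟩, rfl⟩ := he
  have hval : ((turn (a + M) (h + (j * L : ℕ))).mapEdgeSet.toEmbedding e').1
    = Sym2.map (turn (a + M) (h + (j * L : ℕ))) e'.1 := rfl
  rw [hval]
  refine ⟨fun v hv => ?_, ⟨_, Sym2.mem_map.2 ⟨v, hv, rfl⟩, ?_⟩, ⟨_, Sym2.mem_map.2 ⟨u, hu, rfl⟩, ?_⟩⟩
  · obtain ⟨u, hu, rfl⟩ := Sym2.mem_map.1 hv
    obtain ⟨h2, h3, h4⟩ := h1 u hu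
    rw [abs_le] at h4
    simp only [turn_apply]
    omega
  · simp only [turn_apply]; omega
  · simp only [turn_apply]; omega

/-- Neighbouring channels may share the column `a + l`. No piece contains an edge lying in that
column, so channels remain edge-disjoint. -/
lemma column_of_mem_channelPiece (hMl : 2 * M + 1 ≤ l) {e : Edge} {o : Option (Fin J)}
    (he : e ∈ channelPiece a h h' l L M o) :
    (∀ v ∈ e.1, a ≤ v.1) ∧ ∃ v ∈ e.1, v.1 < a + l := by
  cases o with
  | none =>
    rcases mem_channelPiece_none he with ⟨i, hi, rfl⟩ | ⟨i, hi, rfl⟩ | ⟨i, hi, rfl⟩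
    all_goals
      simp only [rightEdge, upEdge, Sym2.mem_iff]
      refine ⟨?_, ⟨_, Or.inl rfl, by simp only; omega⟩⟩
      rintro _ (rfl | rfl) <;> simp <;> omega
  | some j =>
    obtain ⟨h1, ⟨v, hv, -⟩, -⟩ := mem_channelPiece_some he
    exact ⟨fun u hu => (h1 u hu).1, v, hv, by have := (h1 v hv).2.1; omega⟩

/-- Edges are separated by height. Since `boxEdges` omits the two end sides, a rotated box has no
edge in its bottom or top row, so it avoids its neighbours in the stack and the connecting rows. -/
lemma disjoint_channelPiece (hJ : h + (J * L : ℕ) ≤ h') {o o' : Option (Fin J)} (ho : o ≠ o') :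
    Disjoint (channelPiece a h h' l L M o) (channelPiece a h h' l L M o') := by
  have hlt : ∀ i j : Fin J, i < j → ∀ e, e ∈ channelPiece a h h' l L M (some i) →
      e ∉ channelPiece a h h' l L M (some j) := by
    intro i j hij e h1 h2
    obtain ⟨-, -, v, hv, hv'⟩ := mem_channelPiece_some h1
    have h3 := ((mem_channelPiece_some h2).1 v hv).2.2
    have : (i : ℕ) * L + L ≤ j * L := by
      rw [← Nat.succ_mul]; exact Nat.mul_le_mul_right _ hij
    omega
  have hnone : ∀ j : Fin J, ∀ e, e ∈ channelPiece a h h' l L M (some j) →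
      e ∉ channelPiece a h h' l L M (none : Option (Fin J)) := by
    intro j e h1 h2
    obtain ⟨-, ⟨v, hv, hv'⟩, ⟨u, hu, hu'⟩⟩ := mem_channelPiece_some h1
    have : (j : ℕ) * L + L ≤ J * L := by
      rw [← Nat.succ_mul]; exact Nat.mul_le_mul_right _ j.2
    rcases mem_channelPiece_none h2 with ⟨i, hi, rfl⟩ | ⟨i, hi, rfl⟩ | ⟨i, hi, rfl⟩
    · simp only [rightEdge, Sym2.mem_iff] at hv
      rcases hv with rfl | rfl <;> simp at hv' <;> omega
    · simp only [rightEdge, Sym2.mem_iff] at hu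
      rcases hu with rfl | rfl <;> simp at hu' <;> omega
    · simp only [upEdge, Sym2.mem_iff] at hu
      rcases hu with rfl | rfl <;> simp at hu' <;> omega
  rw [Finset.disjoint_left]
  intro e h1 h2
  match o, o' with
  | none, none => exact ho rfl
  | some i, none => exact hnone i e h1 h2
  | none, some j => exact hnone j e h2 h1
  | some i, some j =>
    rcases lt_trichotomy i j with hij | rfl | hij
    · exact hlt i j hij e h1 h2
    · exact ho rfl
    · exact hlt j i hij e h2 h1

lemma pairwise_disjoint_channelPiece (hMl : 2 * M + 1 ≤ l) (hJ : h + (J * L : ℕ) ≤ h') :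
    Pairwise (Function.onFun Disjoint
      fun i : ℕ × Option (Fin J) => channelPiece (a + i.1 * l) h h' l L M i.2) := by
  have hlt : ∀ k k' : ℕ, k < k' → ∀ o o' : Option (Fin J), ∀ e,
      e ∈ channelPiece (a + k * l) h h' l L M o →
      e ∉ channelPiece (a + k' * l) h h' l L M o' := by
    intro k k' hk o o' e h1 h2
    obtain ⟨-, v, hv, hv'⟩ := column_of_mem_channelPiece hMl h1
    have h3 := (column_of_mem_channelPiece hMl h2).1 v hv
    have : (k : ℤ) * l + l ≤ k' * l := by
      have : (k + 1) * l ≤ k' * l := Nat.mul_le_mul_right _ hk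
      rw [Nat.succ_mul] at this
      exact_mod_cast this
    omega
  rintro ⟨k, o⟩ ⟨k', o'⟩ hne
  simp only [Function.onFun]
  rcases lt_trichotomy k k' with hk | rfl | hk
  · exact Finset.disjoint_left.2 fun e => hlt k k' hk o o' e
  · exact disjoint_channelPiece hJ fun ho => hne (by rw [ho])
  · exact Finset.disjoint_right.2 fun e => hlt k' k hk o' o e

end Pieces

/-! ### Moment generating function of the cost of a channel. -/

namespace IIDWeights

variable {Ω : Type*} [MeasurableSpace Ω] {P : Measure Ω} [IsProbabilityMeasure P]
  {t : Edge → Ω → ℝ}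

lemma identDistrib_channelCost_some (ht : IIDWeights P t) (τ : ℝ) (a h h' : ℤ) (l L M : ℕ) {J : ℕ}
    (j : Fin J) :
    IdentDistrib (fun ω => channelCost τ a h h' l L M (some j) fun e => t e ω)
      (fun ω => restrictedTime (boxEdges L M) (0, 0) ((0, 0) + ((L : ℤ), 0))
        (fun e => t e ω) - τ * L) P P :=
  ht.identDistrib_comp (f := fun w => restrictedTime (boxEdges L M) (0, 0)
    ((0, 0) + ((L : ℤ), 0)) w - τ * L) (measurable_restrictedTime.sub_const _)
    (turn (a + M) (h + (j * L : ℕ))).mapEdgeSet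

lemma integrable_exp_channelCost (ht : IIDWeights P t) {τ θ : ℝ} {L M : ℕ}
    (h1 : Integrable (fun ω => Real.exp (θ * (restrictedTime (boxEdges L M) (0, 0)
      ((0, 0) + ((L : ℤ), 0)) (fun e => t e ω) - τ * L))) P)
    (h3 : ∀ e, Integrable (fun ω => Real.exp (3 * θ * t e ω)) P) (a h h' : ℤ) (l : ℕ) {J : ℕ}
    (o : Option (Fin J)) :
    Integrable (fun ω => Real.exp (θ * channelCost τ a h h' l L M o fun e => t e ω)) P := by
  cases o with
  | none =>
    have := ht.indep.integrable_exp_mul_sum ht.measurable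
      (s := connectorEdges a h h' (a + M) (h + (J * L : ℕ)) l L) fun e _ => h3 e
    refine this.congr (.of_forall fun ω => ?_)
    simp only [channelCost, Finset.sum_apply]
    congr 1
    ring
  | some j =>
    have hid := (ht.identDistrib_channelCost_some τ a h h' l L M j).comp
      (u := fun x => Real.exp (θ * x)) (by fun_prop)
    exact hid.integrable_iff.2 h1

/-- Each box contributes a factor at most `1`, so only the connector counts and the bound does not
depend on `J`. The factor `3` in its cost turns `θ` into `3 * θ`. -/
lemma prod_mgf_channelCost_le (ht : IIDWeights P t) {τ θ : ℝ} {L M : ℕ} (hθ : 0 ≤ θ)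
    (h1 : mgf (fun ω => restrictedTime (boxEdges L M) (0, 0)
      ((0, 0) + ((L : ℤ), 0)) (fun e => t e ω) - τ * L) P θ ≤ 1)
    (h3 : ∀ e, Integrable (fun ω => Real.exp (3 * θ * t e ω)) P) (a h h' : ℤ) (l : ℕ) (J : ℕ) :
    ∏ o : Option (Fin J), mgf (fun ω => channelCost τ a h h' l L M o fun e => t e ω) P θ
      ≤ mgf (t (rightEdge (0, 0))) P (3 * θ) ^ (2 * l + L) := by
  rw [Fintype.prod_option]
  have hB := ht.one_le_mgf (mul_nonneg zero_le_three hθ) _ (h3 (rightEdge (0, 0)))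
  have hnone : mgf (fun ω => channelCost τ a h h' l L M (none : Option (Fin J))
      fun e => t e ω) P θ ≤ mgf (t (rightEdge (0, 0))) P (3 * θ) ^ (2 * l + L) := by
    set R := connectorEdges a h h' (a + M) (h + (J * L : ℕ)) l L with hR
    have hs := ht.indep.mgf_sum (t := 3 * θ) ht.measurable R
    simp only [fun e => ht.mgf_eq e (3 * θ), Finset.prod_const] at hs
    have he : mgf (fun ω => channelCost τ a h h' l L M (none : Option (Fin J))
        fun e => t e ω) P θ = mgf (∑ e ∈ R, t e) P (3 * θ) := by
      rw [← mgf_const_mul]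
      simp only [channelCost, Finset.sum_apply, hR]
    rw [he, hs]
    exact pow_le_pow_right₀ hB (card_connectorEdges_le ..)
  have hsome : ∏ j : Fin J, mgf (fun ω => channelCost τ a h h' l L M (some j)
      fun e => t e ω) P θ ≤ 1 := by
    refine Finset.prod_le_one (fun _ _ => mgf_nonneg) fun j _ => ?_
    rwa [mgf_congr_identDistrib (ht.identDistrib_channelCost_some τ a h h' l L M j)]
  calc _ ≤ mgf (t (rightEdge (0, 0))) P (3 * θ) ^ (2 * l + L) * 1 :=
        mul_le_mul hnone hsome (Finset.prod_nonneg fun _ _ => mgf_nonneg) (by positivity)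
    _ = _ := mul_one _

lemma exists_exponent (ht : IIDWeights P t) {τ : ℝ} (hτ : timeConstant P t < τ) :
    0 ≤ τ ∧ ∃ L : ℕ, 0 < L ∧ ∃ M : ℕ, ∃ θ : ℝ, 0 < θ ∧
      Integrable (fun ω => Real.exp (θ * (restrictedTime (boxEdges L M) (0, 0)
        ((0, 0) + ((L : ℤ), 0)) (fun e => t e ω) - τ * L))) P ∧
      mgf (fun ω => restrictedTime (boxEdges L M) (0, 0)
        ((0, 0) + ((L : ℤ), 0)) (fun e => t e ω) - τ * L) P θ ≤ 1 ∧
      ∀ e, Integrable (fun ω => Real.exp (3 * θ * t e ω)) P := by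
  obtain ⟨L, hL, M, hlt⟩ := ht.exists_integral_boxEdges_lt hτ
  have hL' : (0 : ℝ) < L := by exact_mod_cast hL
  have hbox := rightEdge_mem_boxEdges (L := L) (M := M) (a := 0) (m := L) le_rfl (by omega)
  constructor
  · have : 0 ≤ τ * L := le_trans
      (integral_nonneg fun ω => restrictedTime_nonneg fun e => ht.nonneg e ω) hlt.le
    exact nonneg_of_mul_nonneg_left this hL'
  refine ⟨L, hL, M, ?_⟩
  obtain ⟨c, hc, hint⟩ := ht.exp_moment
  have h0 := ht.zero_mem_interior_integrableExpSet hbox (τ * L)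
  have hneg : ∫ ω, (restrictedTime (boxEdges L M) (0, 0)
      ((0, 0) + ((L : ℤ), 0)) (fun e => t e ω) - τ * L) ∂P < 0 := by
    rw [integral_sub (ht.integrable_restrictedTime hbox) (integrable_const _)]
    simpa using hlt
  have hsmall : ∀ᶠ θ : ℝ in 𝓝[>] 0, θ < c / 3 :=
    mem_nhdsWithin_of_mem_nhds (gt_mem_nhds (by positivity))
  obtain ⟨θ, ⟨⟨h1, h2⟩, h3⟩, h4⟩ := (((eventually_mgf_le_one h0 hneg).and
    (mem_nhdsWithin_of_mem_nhds (mem_interior_iff_mem_nhds.1 h0))).and hsmall).and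
      self_mem_nhdsWithin |>.exists
  exact ⟨θ, h4, h2, h1, fun e => ht.integrable_exp_mul_of_le (by linarith) hint e⟩

end IIDWeights

/-! ### Counting bad channels and the final estimate. -/

lemma exists_bad_channels {w : Edge → ℝ} {ν ε δ : ℝ} {n l K : ℕ}
    (hK : ∀ k : ℕ, (k : ℝ) ≤ 2 * δ * n / l ↔ k < K) (hK' : 2 * δ * n / l ≤ K)
    (h : ¬ MostChannelsGood w ν ε δ n l) :
    ∃ A ⊆ Finset.range K, 1 / 10 * (2 * δ * n / l) ≤ (A.card : ℝ) ∧
      ∀ k ∈ A, ¬ GoodChannel w ν ε δ n l k := by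
  classical
  refine ⟨(Finset.range K).filter fun k => ¬ GoodChannel w ν ε δ n l k, Finset.filter_subset _ _,
    ?_, fun k hk => (Finset.mem_filter.1 hk).2⟩
  have hset : {k : ℕ | (k : ℝ) ≤ 2 * δ * n / l ∧ GoodChannel w ν ε δ n l k}
      = ((Finset.range K).filter fun k => GoodChannel w ν ε δ n l k : Finset ℕ) := by
    ext k
    simp [hK]
  rw [MostChannelsGood, hset, Set.ncard_coe_finset, not_le] at h
  have hcard := Finset.card_filter_add_card_filter_not (s := Finset.range K)
    (fun k => GoodChannel w ν ε δ n l k)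
  rw [Finset.card_range] at hcard
  have : (K : ℝ) = _ := congrArg Nat.cast hcard.symm
  push_cast at this
  linarith

namespace IIDWeights

variable {Ω : Type*} [MeasurableSpace Ω] {P : Measure Ω} [IsProbabilityMeasure P]
  {t : Edge → Ω → ℝ}

theorem prob_mostChannelsGood (ht : IIDWeights P t) {ε : ℝ} (hε : 0 < ε) :
    ∃ l₀ : ℕ, 0 < l₀ ∧ ∀ l : ℕ, l₀ ≤ l → ∀ δ : ℝ, 0 < δ → δ < 1 / 4 →
      ∃ c : ℝ, 0 < c ∧ ∃ n₀ : ℕ, ∀ n : ℕ, n₀ ≤ n →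
        1 - Real.exp (-(c * (n : ℝ) ^ 2)) ≤
          P.real {ω | MostChannelsGood (fun e => t e ω) (timeConstant P t) ε δ n l} := by
  set ν := timeConstant P t
  obtain ⟨hτ, L, hL, M, θ, hθ, hint, hmgf, hint3⟩ :=
    ht.exists_exponent (τ := ν + ε / 10) (by simp only [ν]; linarith)
  set τ := ν + ε / 10 with hτν
  refine ⟨2 * M + 1, by omega, fun l hl δ hδ hδ' => ?_⟩
  have hl' : (0 : ℝ) < l := by exact_mod_cast (by omega : 0 < l)
  set C := mgf (t (rightEdge (0, 0))) P (3 * θ) ^ (2 * l + L) with hC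
  have hC0 : 0 < C := pow_pos (one_pos.trans_le
    (ht.one_le_mgf (by positivity) _ (hint3 (rightEdge (0, 0))))) _
  -- Half of the Chernoff exponent divided by `n²`: the exponent is `2cn²`, and one `cn²` is spent
  -- on the factor `2^K`.
  set c := θ * ε * δ / (400 * l) with hc
  have hcpos : 0 < c := by positivity
  -- From `n₁` on, `C` and the rounding loss `θτ` use at most half of `θεn/20`; from `n₂` on, `K ≤
  -- cn²`.
  obtain ⟨n₁, hn₁⟩ := exists_nat_ge ((Real.log C + θ * τ) / (θ * ε / 40))
  obtain ⟨n₂, hn₂⟩ := exists_nat_ge ((2 * δ / l + 1) / c)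
  refine ⟨c, hcpos, max (max n₁ n₂) 1, fun n hn => ?_⟩
  simp only [max_le_iff] at hn
  have hn1 : Real.log C + θ * τ ≤ θ * ε / 40 * n := by
    rw [div_le_iff₀ (by positivity)] at hn₁
    have : (n₁ : ℝ) ≤ n := by exact_mod_cast hn.1.1
    nlinarith [mul_pos hθ hε]
  have hn2 : 2 * δ / l + 1 ≤ c * n := by
    rw [div_le_iff₀ hcpos] at hn₂
    have : (n₂ : ℝ) ≤ n := by exact_mod_cast hn.1.2
    nlinarith
  have hn3 : (1 : ℝ) ≤ n := by exact_mod_cast hn.2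
  set h := ⌊δ * n⌋ with hh
  set h' := ⌊(1 - δ) * n⌋ with hh'
  have hhh : h ≤ h' := Int.floor_le_floor (by nlinarith)
  set J := ((h' - h) / L).toNat with hJ
  have hLz : (0 : ℤ) < L := by exact_mod_cast hL
  have hJz : (J : ℤ) = (h' - h) / L :=
    Int.toNat_of_nonneg (Int.ediv_nonneg (by omega) hLz.le)
  have hJ1 : h + (J * L : ℕ) ≤ h' := by
    have := Int.ediv_mul_le (h' - h) hLz.ne'
    push_cast
    rw [hJz]
    omega
  have hJ2 : h' < h + (J * L : ℕ) + L := by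
    have := Int.lt_ediv_add_one_mul_self (h' - h) hLz
    push_cast
    rw [hJz]
    rw [add_mul, one_mul] at this
    omega
  have hJR : (J : ℝ) * L ≤ (1 - 2 * δ) * n + 1 := by
    have h1 : ((h + (J * L : ℕ) : ℤ) : ℝ) ≤ h' := by exact_mod_cast hJ1
    push_cast at h1
    have h2 := Int.floor_le ((1 - δ) * n)
    have h3 := Int.lt_floor_add_one (δ * n)
    rw [← hh'] at h2
    rw [← hh] at h3
    linarith
  -- The allowance exceeds `τ(1 - 2δ)n` by `(ε/10)(1 - 2δ)n`, which is at least `εn/20` because `δ <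
  -- 1/4`. Rounding can make the stack taller than `(1 - 2δ)n` by at most `1`, which costs `τ`.
  set u : ℝ := ε * n / 20 - τ with hu
  have hgood : ∀ ω k, ¬ GoodChannel (fun e => t e ω) ν ε δ n l k →
      u ≤ ∑ o : Option (Fin J), channelCost τ (⌈-(δ * n)⌉ + k * l) h h' l L M o
        fun e => t e ω := by
    intro ω k hk
    by_contra! hlt
    refine hk (goodChannel_of_lt (L := L) (M := M) (J := J) (fun e => ht.nonneg e ω) hl hJ1 hJ2 ?_)
    rw [sum_channelCost] at hlt
    have h1 := mul_le_mul_of_nonneg_left hJR hτ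
    have h2 : ε * n / 20 ≤ ε / 10 * ((1 - 2 * δ) * n) := by
      have : 1 / 2 * (n : ℝ) ≤ (1 - 2 * δ) * n := by gcongr; linarith
      nlinarith
    have h3 : (ν + ε / 5) * (1 - 2 * δ) * n =
      τ * ((1 - 2 * δ) * n) + ε / 10 * ((1 - 2 * δ) * n) := by rw [hτν]; ring
    rw [h3]
    linarith
  set ρ := θ * ε * n / 40 with hρ
  have hCρ : C * Real.exp (-(θ * u)) ≤ Real.exp (-ρ) := by
    rw [← Real.exp_log hC0, ← Real.exp_add, Real.exp_le_exp, hu, hρ]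
    linarith
  set K := ⌊2 * δ * n / l⌋₊ + 1 with hK
  have hKnn : 0 ≤ 2 * δ * n / l := by positivity
  have hbad : P.real {ω | MostChannelsGood (fun e => t e ω) ν ε δ n l}ᶜ ≤
      2 ^ K * Real.exp (-(ρ * (1 / 10 * (2 * δ * n / l)))) := by
    refine le_trans (measureReal_mono fun ω hω => ?_) (ht.prob_many_large_le
      (f := fun k (o : Option (Fin J)) => channelCost τ (⌈-(δ * n)⌉ + k * l) h h' l L M o)
      (S := fun k (o : Option (Fin J)) => channelPiece (⌈-(δ * n)⌉ + k * l) h h' l L M o)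
      (pairwise_disjoint_channelPiece hl hJ1) (fun _ _ => measurable_channelCost _)
      (fun _ _ => dependsOn_channelCost _) hθ.le
      (fun _ _ => ht.integrable_exp_channelCost hint hint3 _ _ _ _ _)
      (fun _ => ht.prod_mgf_channelCost_le hθ.le hmgf hint3 _ _ _ _ _)
      (by positivity) hCρ K _)
    obtain ⟨A, hA, hm, hAbad⟩ := exists_bad_channels (K := K) (fun k => by
      rw [hK, Nat.lt_succ_iff, Nat.le_floor_iff hKnn]) (by
      rw [hK]; push_cast; exact (Nat.lt_floor_add_one _).le) hω
    exact ⟨A, hA, hm, fun k hk => hgood ω k (hAbad k hk)⟩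
  have hK2 : (K : ℝ) ≤ c * n ^ 2 := by
    have h1 := Nat.floor_le hKnn
    have h2 : 2 * δ * n / l = 2 * δ / l * n := by ring
    rw [hK]
    push_cast
    nlinarith
  have hexp : 2 ^ K * Real.exp (-(ρ * (1 / 10 * (2 * δ * n / l)))) ≤
      Real.exp (-(c * (n : ℝ) ^ 2)) := by
    have h2 : (2 : ℝ) ^ K ≤ Real.exp K := by
      rw [← Real.exp_one_pow]
      exact pow_le_pow_left₀ zero_le_two (by linarith [Real.add_one_le_exp 1]) _
    have h3 : ρ * (1 / 10 * (2 * δ * n / l)) = 2 * (c * n ^ 2) := by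
      rw [hρ, hc]; field_simp; ring
    calc _ ≤ Real.exp K * Real.exp (-(ρ * (1 / 10 * (2 * δ * n / l)))) := by gcongr
      _ ≤ _ := by
        rw [← Real.exp_add, Real.exp_le_exp, h3]
        linarith
  -- Subadditivity suffices here, so measurability of the event is not required.
  have hone : 1 ≤ P.real {ω | MostChannelsGood (fun e => t e ω) ν ε δ n l} +
      P.real {ω | MostChannelsGood (fun e => t e ω) ν ε δ n l}ᶜ := by
    have := measureReal_union_le (μ := P)
      {ω | MostChannelsGood (fun e => t e ω) ν ε δ n l}
      {ω | MostChannelsGood (fun e => t e ω) ν ε δ n l}ᶜ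
    rwa [Set.union_compl_self, probReal_univ] at this
  linarith

end IIDWeights

end FPP

theorem proposition2p2 {Ω : Type*} [MeasurableSpace Ω] (P : Measure Ω) [IsProbabilityMeasure P]
    (t : FPP.Edge → Ω → ℝ)
    (hmeas : ∀ e, Measurable (t e))
    (hindep : iIndepFun t P)
    (hident : ∀ e e', IdentDistrib (t e) (t e') P P)
    (hnonneg : ∀ e, ∀ᵐ ω ∂P, 0 ≤ t e ω)
    (hexp : ∃ c₀ : ℝ, 0 < c₀ ∧ ∀ e, Integrable (fun ω => Real.exp (c₀ * t e ω)) P) :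
    ∃ ε₀ : ℝ, 0 < ε₀ ∧ ∃ δ₀ : ℝ, 0 < δ₀ ∧
      ∀ ε : ℝ, 0 < ε → ε < ε₀ →
        ∃ l₀ : ℕ, 0 < l₀ ∧ ∀ l : ℕ, l₀ ≤ l →
          ∀ δ : ℝ, 0 < δ → δ < δ₀ →
            ∃ c : ℝ, 0 < c ∧ ∃ n₀ : ℕ, ∀ n : ℕ, n₀ ≤ n →
              1 - Real.exp (-(c * (n : ℝ) ^ 2)) ≤
                P.real {ω | FPP.MostChannelsGood (fun e => t e ω)
                  (FPP.timeConstant P t) ε δ n l} := by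
  -- Truncation at `0` makes the weights nonnegative at every `ω`. It changes them only on a null
  -- set, so the time constant and the probability of the event are preserved.
  set s : FPP.Edge → Ω → ℝ := fun e ω => max (t e ω) 0 with hs
  have hmax : Measurable fun x : ℝ => max x 0 := by fun_prop
  have hae : ∀ᵐ ω ∂P, ∀ e, s e ω = t e ω :=
    ae_all_iff.2 fun e => (hnonneg e).mono fun ω hω => max_eq_left hω
  have hS : FPP.IIDWeights P s :=
    { measurable := fun e => hmax.comp (hmeas e)
      indep := hindep.comp (fun _ x => max x 0) fun _ => hmax
      ident := fun e e' => (hident e e').comp hmax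
      nonneg := fun e ω => le_max_right _ _
      exp_moment := by
        obtain ⟨c, hc, h⟩ := hexp
        exact ⟨c, hc, fun e => (h e).congr (hae.mono fun ω hω => by simp only [hω e])⟩ }
  have hfun : ∀ᵐ ω ∂P, (fun e => s e ω) = fun e => t e ω := hae.mono fun ω hω => funext hω
  have hν : FPP.timeConstant P s = FPP.timeConstant P t :=
    essSup_congr_ae (hfun.mono fun ω hω => by simp only [hω])
  -- Any `ε₀` would do; `1/4` ensures `1 - 2δ ≥ 1/2`.
  refine ⟨1, one_pos, 1 / 4, by norm_num, fun ε hε _ => ?_⟩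
  obtain ⟨l₀, hl₀, H⟩ := hS.prob_mostChannelsGood hε
  refine ⟨l₀, hl₀, fun l hl δ hδ hδ' => ?_⟩
  obtain ⟨c, hc, n₀, hn₀⟩ := H l hl δ hδ hδ'
  refine ⟨c, hc, n₀, fun n hn => (hn₀ n hn).trans_eq (measureReal_congr ?_)⟩
  filter_upwards [hfun] with ω hω
  change FPP.MostChannelsGood (fun e => s e ω) _ ε δ n l =
    FPP.MostChannelsGood (fun e => t e ω) _ ε δ n l
  rw [hω, hν]
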